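/- **Conventions.** Fix $n\ge 1$. All manifolds are smooth, compact and Hausdorff, possibly with boundary and possibly empty; rings are commutative. *Embeddings.* A tame embedding $W\to W'$ of $n$-manifolds is a smooth embedding that sends each connected component of $\partial W$ either into $\partial W'$ or into the interior of $W'$, and the interior of $W$ into the interior of $W'$. Let $\mathbf{Emb}_c$ be the category of $n$-manifolds and tame embeddings, where two embeddings are identified if a smooth ambient diffeotopy, starting at the identity and fixed on the boundary, carries one to the other. A *sheaf* is a functor $\mathcal S:\mathbf{Emb}_c^{op}\to\mathbf{Cat}$ such that compatible families of objects, and compatible families of morphisms, glue uniquely along every finite covering of an $n$-manifold by compact submanifolds whose pairwise intersections are covered by compact submanifolds (in particular $\mathcal S(\emptyset)$ has one object and one morphism). Let $\mathbf{Emb}^{\mathcal S}_c$ be the category of pairs $(W,s)$, $s\in\mathcal S(W)$, where a morphism $(W_1,s_1)\to(W_2,s_2)$ is a pair $(f,\alpha)$ with $f:W_1\to W_2$ in $\mathbf{Emb}_c$ and $\alpha:s_1\to\mathcal S(f)(s_2)$. An embedding $f$ with $\mathcal S(f)(s_2)=s_1$ is regarded as the morphism $(f,\mathrm{id})$. A closed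 $(n-1)$-manifold $M$ is regarded as an object through its collar $M\times[0,1]$, and a structure on $M$ means an object of $\mathcal S(M\times[0,1])$. *Gluing.* Let $f_1:M\times[0,1]\to W_1$ and $f_2:M\times[0,1]\to W_2$ be tame embeddings with $f_1(M\times 1)\subset\partial W_1$ and $f_2(M\times 0)\subset\partial W_2$. An $n$-manifold $P$ is a gluing $W_1\cup_M W_2$ if it is the union of embedded copies of $W_1$ and $W_2$ that agree on $M\times[0,1]$ and meet exactly there. A contravariant functor $F:\mathbf{Emb}^{\mathcal S}_c\to\mathcal C$ has the *Seifert–van Kampen property* if it sends the empty manifold to a final object, and every square $M, W_1,W_2, W_1\cup_MW_2$ of this kind, with structures restricting to each other, to a pullback square. *The 2-category $\mathbf{Bd}_n^{\mathcal S}$.* Objects are pairs $(M,s)$ with $M$ a closed $(n-1)$-manifold and $s$ a structure on it. A 1-morphism $(M_1,s_1)\to(M_2,s_2)$ is an $n$-manifold $(W,s)$ with tame embeddings $i_1:M_1\times[0,1]\to W$, $i_2:M_2\times[0,1]\to W$ such that $\partial W=i_1(M_1\times 0)\sqcup i_2(M_2\times 1)$, such that $s$ restricts to $s_1$ and $s_2$,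 and such that the two collars are disjoint except on a union of connected components of $W$ (where both are everything). The identity is $M\times[0,1]$, and composition is gluing. A 2-morphism $(W,s)\Rightarrow(W',s')$ is a morphism $(f,\alpha)$ of $\mathbf{Emb}^{\mathcal S}_c$ with $f$ invertible in $\mathbf{Emb}_c$ and $(f,\alpha)\circ i_j=i'_j$ for $j=1,2$. The monoidal structure is disjoint union. *$\mathcal C$-algebras.* Let $\mathcal C$ be a category with a final object $\star$ and pullbacks. A $\mathcal C$-algebra $\mathcal A$ is a contravariant functor $c\mapsto\mathcal A_c$, $f\mapsto f^*$, to commutative rings (so each $\mathcal A_c$ is an $\mathcal A_\star$-algebra) and a covariant functor $f\mapsto f_!$ to $\mathcal A_\star$-modules with the same values $\mathcal A_c$ on objects, such that (i) $g^*f_!=(f')_!(g')^*$ for every pullback square with $f g'=g f'$; (ii) for $f:a\to a'$, $g:b\to b'$ the external product $\boxtimes:\mathcal A_a\otimes\mathcal A_b\to\mathcal A_{a\times b}$, $z\boxtimes w=p_1^*(z)\,p_2^*(w)$, satisfies $(f\times g)_!(z\boxtimes w)=f_!(z)\boxtimes g_!(w)$. *$R\text{-}\mathbf{Mod}_t$.*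 Let $R$ be a commutative ring. Objects are $R$-algebras, 1-morphisms are $R$-linear maps. An immediate twist $f\Rightarrow g$ between $f,g:M\to N$ consists of factorisations $M\xrightarrow{\phi}L\xrightarrow{\psi}N$ of $f$ and $M\xrightarrow{\phi'}L'\xrightarrow{\psi'}N$ of $g$ with $\phi,\phi'$ algebra homomorphisms and $\psi,\psi'$ linear, an algebra homomorphism $\alpha^{alg}:L\to L'$ with $\alpha^{alg}\phi=\phi'$, and a linear map $\alpha^{mod}:L'\to L$ with $\psi\alpha^{mod}=\psi'$. A 2-morphism (twist) is a finite composable sequence of immediate twists, where two consecutive immediate twists through the same factorisation of the middle map are identified with their composite, and an immediate twist with $\alpha^{alg}$ and $\alpha^{mod}$ mutually inverse is identified with the identity. Two immediate twists of maps $M\to N$ and of maps $M'\to N'$ *correspond* along linear maps $p:M\to M'$, $q:N\to N'$ if there are linear maps between their middle algebras commuting with $p$, $q$, the factorisations, and the maps $\alpha^{alg}$, $\alpha^{mod}$. **Theorem.** Let $\mathcal C$ be a category with a final object $\star$ and pullbacks, $\mathcal S$ a sheaf, $F:\mathbf{Emb}_c^{\mathcal S}\to\mathcal C$ a contravariant functor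 with the Seifert–van Kampen property, and $\mathcal A$ a $\mathcal C$-algebra. Composing the field theory $(W,s)\mapsto\big(F(M_1,s_1)\xleftarrow{F(i_1)}F(W,s)\xrightarrow{F(i_2)}F(M_2,s_2)\big)$ with values in spans with the quantisation $\big(a\xleftarrow{f}d\xrightarrow{g}b\big)\mapsto g_!\circ f^*$ gives a lax monoidal Topological Quantum Field Theory over $\mathcal S$, $$Z_{F,\mathcal A}:\mathbf{Bd}_n^{\mathcal S}\to\mathcal A_\star\text{-}\mathbf{Mod}_t .$$ Explicitly, put - $Z(M,s)=\mathcal A_{F(M,s)}$ for an object $(M,s)$; - $Z(W,s)=F(i_2)_!\circ F(i_1)^*:\mathcal A_{F(M_1,s_1)}\to\mathcal A_{F(M_2,s_2)}$ for a bordism; - $Z(\varphi)$, for a 2-morphism $\varphi:(W,s)\Rightarrow(W',s')$, the class of the immediate twist through $\mathcal A_{F(W,s)}$ and $\mathcal A_{F(W',s')}$ with $\alpha^{alg}=F(\varphi)^*$ and $\alpha^{mod}=F(\varphi)_!$; - unit constraint the structure map $\mathcal A_\star\to\mathcal A_{F(\emptyset)}$, and monoidal constraint $\Delta:Z(X)\otimes_{\mathcal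 A_\star}Z(X')\to Z(X\sqcup X')$, $\Delta(z\otimes w)=F(\iota)^*(z)\,F(\iota')^*(w)$, for the inclusions $\iota,\iota'$ of the two summands. Then: 1. $Z$ preserves identity 2-morphisms and vertical composition of 2-morphisms. 2. $Z$ sends identity bordisms to identities and $Z(P)=Z(W')\circ Z(W)$ for every composite $P$ of $W$ and $W'$; the canonical 2-morphisms between two models of a composite, between $(W_1,W_2,W_3)$-composites bracketed in the two ways, and between $W$ and its composite with an identity bordism are sent to identities. 3. If $\psi$ is the horizontal composite of a 2-morphism $\varphi$ with a bordism $W'$ on either side, then immediate twists representing $Z(\varphi)$ and $Z(\psi)$ correspond along $Z(W')$ and the identity. 4. $\Delta$ is natural with respect to bordisms, $Z(W\sqcup W')\circ\Delta=\Delta\circ(Z(W)\otimes Z(W'))$, and with respect to 2-morphisms: if $\psi$ is the disjoint union of $\varphi$ and $\varphi'$, then the tensor product of immediate twists representing $Z(\varphi)$ and $Z(\varphi')$ corresponds along $\Delta$ to an immediate twist representing $Z(\psi)$. 5. $\Delta$ and the unit constraint are unital, associative and symmetric. -/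

import Mathlib

open CategoryTheory Limits Opposite
open scoped Manifold ContDiff TensorProduct

universe w₁ w₂ u₁ u₂ v

noncomputable section

namespace PushPull

/-! ## Compact manifolds and tame embeddings

All manifolds have dimension `n = m + 1 ≥ 1`. They are modelled on the half space `ℝ^m × [0, ∞)`,
so that the cylinder over an `m`-dimensional manifold is again one of them. -/

/-- The half space `ℝ^m × [0, ∞)`. -/
abbrev HalfSpace (m : ℕ) : Type := ModelProd (EuclideanSpace ℝ (Fin m)) (EuclideanHalfSpace 1)

/-- The model of `(m + 1)`-dimensional manifolds with boundary. -/
abbrev halfModel (m : ℕ) :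
    ModelWithCorners ℝ (EuclideanSpace ℝ (Fin m) × EuclideanSpace ℝ (Fin 1)) (HalfSpace m) :=
  (𝓡 m).prod (𝓡∂ 1)

/-- A compact smooth manifold of dimension `m + 1`, possibly with boundary, possibly empty. -/
structure CompactManifold (m : ℕ) where
  carrier : Type
  [top : TopologicalSpace carrier]
  [compact : CompactSpace carrier]
  [t2 : T2Space carrier]
  [charted : ChartedSpace (HalfSpace m) carrier]
  [smooth : IsManifold (halfModel m) ∞ carrier]

attribute [instance] CompactManifold.top CompactManifold.compact CompactManifold.t2
  CompactManifold.charted CompactManifold.smooth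

/-- The boundary of a compact manifold. -/
def CompactManifold.bd {m : ℕ} (M : CompactManifold m) : Set M.carrier :=
  (halfModel m).boundary M.carrier

/-- A smooth tame embedding between compact manifolds of the same dimension: a smooth injective
immersion under which each connected component of the boundary of the source goes either
into the boundary or into the interior of the target, and no other point goes to the boundary.
(The components going into the interior form the union `N` of components along which the
map is to extend over a collar `N × [0, 1]` in the interior of the target; as the dimensions agree,
such an extension always exists.) -/
@[ext]
structure TameEmb {m : ℕ} (M N : CompactManifold m) where
  toFun : M.carrier → N.carrier
  smooth : ContMDiff (halfModel m) (halfModel m) ∞ toFun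
  injective : Function.Injective toFun
  immersive : ∀ x, Function.Injective (mfderiv (halfModel m) (halfModel m) toFun x)
  bd_of_bd : ∀ x, toFun x ∈ N.bd → x ∈ M.bd
  components : ∀ x, toFun x ∈ N.bd → ∀ y ∈ connectedComponentIn M.bd x, toFun y ∈ N.bd

/-- The identity is tame. -/
def TameEmb.id {m : ℕ} (M : CompactManifold m) : TameEmb M M where
  toFun x := x
  smooth := contMDiff_id
  injective := Function.injective_id
  immersive x := by
    have : mfderiv (halfModel m) (halfModel m) (fun y : M.carrier => y) x
        = ContinuousLinearMap.id ℝ _ := mfderiv_id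
    rw [this]
    exact Function.injective_id
  bd_of_bd _ h := h
  components _ _ _ hy := connectedComponentIn_subset _ _ hy

/-- The composition of tame embeddings is tame. -/
def TameEmb.comp {m : ℕ} {M N P : CompactManifold m} (f : TameEmb M N) (g : TameEmb N P) :
    TameEmb M P where
  toFun x := g.toFun (f.toFun x)
  smooth := g.smooth.comp f.smooth
  injective := g.injective.comp f.injective
  immersive x := by
    have h := mfderiv_comp (I := halfModel m) (I' := halfModel m) (I'' := halfModel m) x
      ((g.smooth (f.toFun x)).mdifferentiableAt (by simp))
      ((f.smooth x).mdifferentiableAt (by simp))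
    intro a b hab
    have h' : mfderiv (halfModel m) (halfModel m) (fun x => g.toFun (f.toFun x)) x = _ := h
    rw [h'] at hab
    exact f.immersive x (g.immersive _ hab)
  bd_of_bd x h := f.bd_of_bd x (g.bd_of_bd _ h)
  components x h y hy := by
    have hx := g.bd_of_bd _ h
    refine g.components _ h _ ?_
    have hsub : f.toFun '' connectedComponentIn M.bd x ⊆ connectedComponentIn N.bd (f.toFun x) := by
      refine IsPreconnected.subset_connectedComponentIn ?_ ?_ ?_
      · exact isPreconnected_connectedComponentIn.image _ f.smooth.continuous.continuousOn
      · exact ⟨x, mem_connectedComponentIn (f.bd_of_bd x hx), rfl⟩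
      · rintro _ ⟨z, hz, rfl⟩
        exact f.components x hx z hz
    exact hsub ⟨y, hy, rfl⟩

instance (m : ℕ) : Category (CompactManifold m) where
  Hom := TameEmb
  id := TameEmb.id
  comp := TameEmb.comp

/-- Two embeddings are related if an ambient diffeotopy of the target, fixed on the boundary and
starting at the identity, takes the first to the second. -/
def Diffeotopic (m : ℕ) : HomRel (CompactManifold m) := fun _ N f g =>
  ∃ h : unitInterval → Diffeomorph (halfModel m) (halfModel m) N.carrier N.carrier ∞,
    ContMDiff ((halfModel m).prod (𝓡∂ 1)) (halfModel m) ∞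
        (fun p : N.carrier × unitInterval => h p.2 p.1) ∧
      (∀ x, h 0 x = x) ∧ (∀ t, ∀ x ∈ N.bd, h t x = x) ∧ ∀ x, h 1 (f.toFun x) = g.toFun x

/-- The category of compact `(m + 1)`-manifolds and classes of tame embeddings up to ambient
diffeotopy. (The quotient is by the congruence generated by `Diffeotopic`.) -/
abbrev EmbC (m : ℕ) := CategoryTheory.Quotient (Diffeotopic m)

/-- The class of a tame embedding. -/
abbrev cls {m : ℕ} {M N : CompactManifold m} (f : M ⟶ N) :
    (⟨M⟩ : EmbC m) ⟶ ⟨N⟩ :=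
  (CategoryTheory.Quotient.functor (Diffeotopic m)).map f

/-! ## Sheaves of structures -/

section Sheaf

variable {m : ℕ} (S : (EmbC m)ᵒᵖ ⥤ Cat.{w₁, w₂})

/-- The category of `S`-structures on `M`. -/
abbrev Str (M : CompactManifold m) : Type w₂ := S.obj (op ⟨M⟩)

/-- Restriction of `S`-structures along a tame embedding. -/
abbrev restr {M N : CompactManifold m} (f : M ⟶ N) : Str S N ⥤ Str S M :=
  (S.map (cls f).op).toFunctor

end Sheaf

/-- A finite covering of `M` by compact submanifolds `W i` whose pairwise intersections `V i k` are
compact submanifolds. -/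
structure ClosedCover {m : ℕ} (M : CompactManifold m) where
  ι : Type
  [finite : Finite ι]
  W : ι → CompactManifold m
  j : ∀ i, W i ⟶ M
  covers : ∀ x : M.carrier, ∃ i y, (j i).toFun y = x
  V : ι → ι → CompactManifold m
  p : ∀ i k, V i k ⟶ W i
  q : ∀ i k, V i k ⟶ W k
  comm : ∀ i k, p i k ≫ j i = q i k ≫ j k
  inter : ∀ i k, Set.range (j i).toFun ∩ Set.range (j k).toFun ⊆ Set.range (p i k ≫ j i).toFun

/-- `S` is a sheaf of categories: compatible families of objects, and of morphisms, glue uniquely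
along finite coverings. (The empty covering gives that `S ∅` has exactly one object and one
morphism.) -/
structure IsSheaf {m : ℕ} (S : (EmbC m)ᵒᵖ ⥤ Cat.{w₁, w₂}) : Prop where
  glue_obj : ∀ {M : CompactManifold m} (c : ClosedCover M) (s : ∀ i, Str S (c.W i)),
    (∀ i k, (restr S (c.p i k)).obj (s i) = (restr S (c.q i k)).obj (s k)) →
    ∃! t : Str S M, ∀ i, (restr S (c.j i)).obj t = s i
  glue_hom : ∀ {M : CompactManifold m} (c : ClosedCover M) (s t : Str S M)
    (a : ∀ i, (restr S (c.j i)).obj s ⟶ (restr S (c.j i)).obj t),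
    (∀ i k, HEq ((restr S (c.p i k)).map (a i)) ((restr S (c.q i k)).map (a k))) →
    ∃! b : s ⟶ t, ∀ i, (restr S (c.j i)).map b = a i

/-! ## Embeddings over a sheaf -/

/-- Objects of the category of `S`-embeddings: manifolds with an `S`-structure. -/
structure EmbS {m : ℕ} (S : (EmbC m)ᵒᵖ ⥤ Cat.{w₁, w₂}) where
  base : EmbC m
  str : S.obj (op base)

/-- A morphism of `S`-embeddings: a class `f` of embeddings and a morphism `s₁ ⟶ S(f)(s₂)`. -/
structure EmbS.Hom {m : ℕ} {S : (EmbC m)ᵒᵖ ⥤ Cat.{w₁, w₂}} (X Y : EmbS S) where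
  base : X.base ⟶ Y.base
  str : X.str ⟶ (S.map base.op).toFunctor.obj Y.str

section

variable {m : ℕ} {S : (EmbC m)ᵒᵖ ⥤ Cat.{w₁, w₂}}

theorem EmbS.map_comp_obj {X Y Z : EmbC m} (f : X ⟶ Y) (g : Y ⟶ Z) (s : S.obj (op Z)) :
    (S.map f.op).toFunctor.obj ((S.map g.op).toFunctor.obj s) =
      (S.map (f ≫ g).op).toFunctor.obj s := by
  rw [op_comp, S.map_comp]; rfl

theorem EmbS.map_id_obj {X : EmbC m} (s : S.obj (op X)) :
    s = (S.map (𝟙 X : X ⟶ X).op).toFunctor.obj s := by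
  rw [op_id, S.map_id]; rfl

theorem EmbS.Hom.ext' {X Y : EmbS S} {f g : EmbS.Hom X Y} (h : f.base = g.base)
    (h' : f.str ≫ eqToHom (by rw [h]) = g.str) : f = g := by
  obtain ⟨f, a⟩ := f
  obtain ⟨g, b⟩ := g
  dsimp at h
  subst h
  simp at h'
  rw [h']

theorem EmbS.map_id_functor (X : EmbC m) :
    (S.map (𝟙 X : X ⟶ X).op).toFunctor = 𝟭 _ := by
  rw [op_id, S.map_id]; rfl

theorem EmbS.map_comp_functor {X Y Z : EmbC m} (f : X ⟶ Y) (g : Y ⟶ Z) :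
    (S.map (f ≫ g).op).toFunctor = (S.map g.op).toFunctor ⋙ (S.map f.op).toFunctor := by
  rw [op_comp, S.map_comp]; rfl

instance : Category (EmbS S) where
  Hom := EmbS.Hom
  id X := ⟨𝟙 X.base, eqToHom (EmbS.map_id_obj X.str)⟩
  comp f g := ⟨f.base ≫ g.base,
    f.str ≫ (S.map f.base.op).toFunctor.map g.str ≫ eqToHom (EmbS.map_comp_obj _ _ _)⟩
  id_comp {X Y} f := by
    refine EmbS.Hom.ext' (Category.id_comp _) ?_
    have := Functor.congr_hom (EmbS.map_id_functor (S := S) X.base) f.str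
    dsimp at this ⊢
    rw [this]
    simp
  comp_id f := by
    refine EmbS.Hom.ext' (Category.comp_id _) ?_
    dsimp
    simp [eqToHom_map]
  assoc f g h := by
    refine EmbS.Hom.ext' (Category.assoc _ _ _) ?_
    have := Functor.congr_hom (EmbS.map_comp_functor (S := S) f.base g.base) h.str
    dsimp at this ⊢
    rw [this]
    simp [eqToHom_map]

/-- A manifold with an `S`-structure as an object of the category of `S`-embeddings. -/
abbrev EmbS.of (M : CompactManifold m) (s : Str S M) : EmbS S := ⟨⟨M⟩, s⟩

/-- An embedding restricting the structure `t` exactly to `s`, as a morphism of `S`-embeddings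
(with identity second component). -/
def EmbS.incl {M N : CompactManifold m} (f : M ⟶ N) {s : Str S M} {t : Str S N}
    (h : (restr S f).obj t = s) : EmbS.of M s ⟶ EmbS.of N t :=
  EmbS.Hom.mk (cls f) (eqToHom h.symm)

end

/-! ## Gluing and the Seifert-van Kampen property -/

/-- A closed `m`-dimensional smooth manifold, possibly empty. -/
structure ClosedManifold (m : ℕ) where
  carrier : Type
  [top : TopologicalSpace carrier]
  [compact : CompactSpace carrier]
  [t2 : T2Space carrier]
  [charted : ChartedSpace (EuclideanSpace ℝ (Fin m)) carrier]
  [smooth : IsManifold (𝓡 m) ∞ carrier]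

attribute [instance] ClosedManifold.top ClosedManifold.compact ClosedManifold.t2
  ClosedManifold.charted ClosedManifold.smooth

/-- The collar `M × [0, 1]`. A closed `m`-manifold `M` is regarded as an object of the category of
embeddings of `(m + 1)`-manifolds through its collar. -/
def ClosedManifold.collar {m : ℕ} (M : ClosedManifold m) : CompactManifold m where
  carrier := M.carrier × unitInterval

/-- The compact manifold `P` is the gluing `W₁ ∪_M W₂` of `W₁` and `W₂` along the closed manifold
`M`: here `f₁` embeds the collar of `M` in `W₁` as a collar of a union of boundary components with
`M × {1}` on the boundary, `f₂` embeds it in `W₂` with `M × {0}` on the boundary, and `P` is the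
union of `W₁` and `W₂`, meeting exactly in the common collar. -/
structure IsGluing {m : ℕ} {M : ClosedManifold m} {W₁ W₂ P : CompactManifold m}
    (f₁ : M.collar ⟶ W₁) (f₂ : M.collar ⟶ W₂) (j₁ : W₁ ⟶ P) (j₂ : W₂ ⟶ P) : Prop where
  bd₁ : ∀ x : M.carrier, f₁.toFun (x, 1) ∈ W₁.bd
  bd₂ : ∀ x : M.carrier, f₂.toFun (x, 0) ∈ W₂.bd
  comm : f₁ ≫ j₁ = f₂ ≫ j₂
  covers : Set.range j₁.toFun ∪ Set.range j₂.toFun = Set.univ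
  inter : Set.range j₁.toFun ∩ Set.range j₂.toFun ⊆ Set.range (f₁ ≫ j₁).toFun

/-- A contravariant functor on `S`-embeddings has the Seifert-van Kampen property if it sends the
empty manifold to a final object and gluing squares to pullback squares. -/
structure SeifertVanKampen {m : ℕ} {S : (EmbC m)ᵒᵖ ⥤ Cat.{w₁, w₂}} {C : Type u₁}
    [Category.{u₂} C] (F : (EmbS S)ᵒᵖ ⥤ C) : Prop where
  empty : ∀ (M : CompactManifold m) (s : Str S M), IsEmpty M.carrier →
    Nonempty (IsTerminal (F.obj (op (EmbS.of M s))))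
  gluing : ∀ {M : ClosedManifold m} {W₁ W₂ P : CompactManifold m} {f₁ : M.collar ⟶ W₁}
    {f₂ : M.collar ⟶ W₂} {j₁ : W₁ ⟶ P} {j₂ : W₂ ⟶ P}, IsGluing f₁ f₂ j₁ j₂ →
    ∀ {t : Str S M.collar} {s₁ : Str S W₁} {s₂ : Str S W₂} {s : Str S P}
      (h₁ : (restr S f₁).obj s₁ = t) (h₂ : (restr S f₂).obj s₂ = t)
      (k₁ : (restr S j₁).obj s = s₁) (k₂ : (restr S j₂).obj s = s₂),
      IsPullback (F.map (EmbS.incl j₁ k₁).op) (F.map (EmbS.incl j₂ k₂).op)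
        (F.map (EmbS.incl f₁ h₁).op) (F.map (EmbS.incl f₂ h₂).op)

/-! ## The 2-category of bordisms over `S`

Composition of bordisms and disjoint unions are described by saying when a bordism *is* a composite
or a disjoint union of two others, so that no choice of a model is involved. -/

section Bordisms

variable {m : ℕ} (S : (EmbC m)ᵒᵖ ⥤ Cat.{w₁, w₂})

/-- Objects: closed `m`-manifolds with an `S`-structure (on the collar). -/
structure BordObj where
  mfd : ClosedManifold m
  str : Str S mfd.collar

variable {S}

/-- The associated object of the category of `S`-embeddings. -/
abbrev BordObj.emb (X : BordObj S) : EmbS S := EmbS.of X.mfd.collar X.str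

/-- 1-morphisms: a compact manifold `W` whose boundary is the disjoint union of the incoming
boundary `X` and the outgoing boundary `Y`, each with a collar in `W`, and an `S`-structure on `W`
restricting to those of `X` and `Y`. The two collars are disjoint, except on some union of connected
components of `W`, which are entire collars (these are degenerate bordisms, such as the identity
bordism `X ⟶ X` given by `X` itself). -/
structure Bord (X Y : BordObj S) where
  mfd : CompactManifold m
  str : Str S mfd
  inn : X.mfd.collar ⟶ mfd
  out : Y.mfd.collar ⟶ mfd
  bd_eq : mfd.bd = Set.range (fun x : X.mfd.carrier => inn.toFun (x, 0)) ∪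
    Set.range (fun y : Y.mfd.carrier => out.toFun (y, 1))
  bd_disjoint : ∀ (x : X.mfd.carrier) (y : Y.mfd.carrier), inn.toFun (x, 0) ≠ out.toFun (y, 1)
  overlap : IsOpen (Set.range inn.toFun ∩ Set.range out.toFun)
  str_inn : (restr S inn).obj str = X.str
  str_out : (restr S out).obj str = Y.str

namespace Bord

variable {X Y Z : BordObj S}

/-- The associated object of the category of `S`-embeddings. -/
abbrev emb (W : Bord X Y) : EmbS S := EmbS.of W.mfd W.str

/-- The inclusion of the incoming boundary. -/
abbrev innEmb (W : Bord X Y) : X.emb ⟶ W.emb := EmbS.incl W.inn W.str_inn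

/-- The inclusion of the outgoing boundary. -/
abbrev outEmb (W : Bord X Y) : Y.emb ⟶ W.emb := EmbS.incl W.out W.str_out

/-- 2-morphisms: morphisms `(f, α)` of `S`-embeddings with `f` a diffeomorphism, compatible with the
inclusions of both boundaries. -/
@[ext]
structure Hom (W W' : Bord X Y) where
  hom : W.emb ⟶ W'.emb
  isIso : IsIso hom.base
  inn : W.innEmb ≫ hom = W'.innEmb
  out : W.outEmb ≫ hom = W'.outEmb

instance : Category (Bord X Y) where
  Hom := Hom
  id W := ⟨𝟙 _, inferInstanceAs (IsIso (𝟙 W.emb.base)), Category.comp_id _, Category.comp_id _⟩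
  comp {U V W} f g :=
    ⟨f.hom ≫ g.hom,
      (by
        have := f.isIso
        have := g.isIso
        exact inferInstanceAs (IsIso (f.hom.base ≫ g.hom.base))),
      by rw [← Category.assoc, f.inn, g.inn], by rw [← Category.assoc, f.out, g.out]⟩
  id_comp f := Hom.ext (Category.id_comp _)
  comp_id f := Hom.ext (Category.comp_id _)
  assoc f g h := Hom.ext (Category.assoc _ _ _)

/-- The identity bordism: `X` itself. -/
def id (X : BordObj S) : Bord X X where
  mfd := X.mfd.collar
  str := X.str
  inn := 𝟙 _
  out := 𝟙 _
  bd_eq := by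
    have h : X.mfd.collar.bd = Set.prod Set.univ {⊥, ⊤} :=
      boundary_product (x := 0) (y := 1) (𝓡 m) (M := X.mfd.carrier)
    rw [h]
    ext ⟨x, t⟩
    constructor
    · rintro ⟨-, h⟩
      rcases h with h | h
      · exact Or.inl ⟨x, Prod.ext rfl h.symm⟩
      · exact Or.inr ⟨x, Prod.ext rfl h.symm⟩
    · rintro (⟨y, h⟩ | ⟨y, h⟩)
      · exact ⟨trivial, Or.inl (congrArg Prod.snd h).symm⟩
      · exact ⟨trivial, Or.inr (congrArg Prod.snd h).symm⟩
  bd_disjoint x y h := zero_ne_one (congrArg Prod.snd h)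
  overlap := by
    have h : Set.range (𝟙 X.mfd.collar : X.mfd.collar ⟶ X.mfd.collar).toFun = Set.univ :=
      Set.range_id
    rw [h, Set.inter_self]
    exact isOpen_univ
  str_inn := (EmbS.map_id_obj X.str).symm
  str_out := (EmbS.map_id_obj X.str).symm

/-- `P : X ⟶ Z` is a composite of `W : X ⟶ Y` and `W' : Y ⟶ Z`: it is the gluing of `W` and `W'` along
`Y`, with the structure glued from those of `W` and `W'`. -/
structure Composite (W : Bord X Y) (W' : Bord Y Z) (P : Bord X Z) where
  j : W.mfd ⟶ P.mfd
  j' : W'.mfd ⟶ P.mfd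
  gluing : IsGluing W.out W'.inn j j'
  inn : W.inn ≫ j = P.inn
  out : W'.out ≫ j' = P.out
  str_j : (restr S j).obj P.str = W.str
  str_j' : (restr S j').obj P.str = W'.str

/-- The inclusion of the first factor in a composite. -/
abbrev Composite.fst {W : Bord X Y} {W' : Bord Y Z} {P : Bord X Z} (c : Composite W W' P) :
    W.emb ⟶ P.emb := EmbS.incl c.j c.str_j

/-- The inclusion of the second factor in a composite. -/
abbrev Composite.snd {W : Bord X Y} {W' : Bord Y Z} {P : Bord X Z} (c : Composite W W' P) :
    W'.emb ⟶ P.emb := EmbS.incl c.j' c.str_j'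

end Bord

/-- `P` is the disjoint union of the objects `X` and `X'`. -/
structure ObjSum (X X' P : BordObj S) where
  e₀ : X.mfd.carrier → P.mfd.carrier
  e₀' : X'.mfd.carrier → P.mfd.carrier
  e : X.mfd.collar ⟶ P.mfd.collar
  e' : X'.mfd.collar ⟶ P.mfd.collar
  e_eq : ∀ x t, e.toFun (x, t) = (e₀ x, t)
  e_eq' : ∀ x t, e'.toFun (x, t) = (e₀' x, t)
  covers : Set.range e₀ ∪ Set.range e₀' = Set.univ
  disjoint : Disjoint (Set.range e₀) (Set.range e₀')
  str_e : (restr S e).obj P.str = X.str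
  str_e' : (restr S e').obj P.str = X'.str

namespace ObjSum

variable {X X' P : BordObj S}

/-- The inclusion of the first summand. -/
abbrev inl (h : ObjSum X X' P) : X.emb ⟶ P.emb := EmbS.incl h.e h.str_e

/-- The inclusion of the second summand. -/
abbrev inr (h : ObjSum X X' P) : X'.emb ⟶ P.emb := EmbS.incl h.e' h.str_e'

/-- Exchanging the summands. -/
def swap (h : ObjSum X X' P) : ObjSum X' X P where
  e₀ := h.e₀'
  e₀' := h.e₀
  e := h.e'
  e' := h.e
  e_eq := h.e_eq'
  e_eq' := h.e_eq
  covers := by rw [Set.union_comm]; exact h.covers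
  disjoint := h.disjoint.symm
  str_e := h.str_e'
  str_e' := h.str_e

end ObjSum

/-- The bordism `V` is the disjoint union of the bordisms `W` and `W'`. -/
structure BordSum {X X' P Y Y' Q : BordObj S} (hP : ObjSum X X' P) (hQ : ObjSum Y Y' Q)
    (W : Bord X Y) (W' : Bord X' Y') (V : Bord P Q) where
  k : W.mfd ⟶ V.mfd
  k' : W'.mfd ⟶ V.mfd
  covers : Set.range k.toFun ∪ Set.range k'.toFun = Set.univ
  disjoint : Disjoint (Set.range k.toFun) (Set.range k'.toFun)
  inn : W.inn ≫ k = hP.e ≫ V.inn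
  inn' : W'.inn ≫ k' = hP.e' ≫ V.inn
  out : W.out ≫ k = hQ.e ≫ V.out
  out' : W'.out ≫ k' = hQ.e' ≫ V.out
  str_k : (restr S k).obj V.str = W.str
  str_k' : (restr S k').obj V.str = W'.str

/-- The inclusion of the first summand. -/
abbrev BordSum.inl {X X' P Y Y' Q : BordObj S} {hP : ObjSum X X' P} {hQ : ObjSum Y Y' Q}
    {W : Bord X Y} {W' : Bord X' Y'} {V : Bord P Q} (c : BordSum hP hQ W W' V) :
    W.emb ⟶ V.emb := EmbS.incl c.k c.str_k

/-- The inclusion of the second summand. -/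
abbrev BordSum.inr {X X' P Y Y' Q : BordObj S} {hP : ObjSum X X' P} {hQ : ObjSum Y Y' Q}
    {W : Bord X Y} {W' : Bord X' Y'} {V : Bord P Q} (c : BordSum hP hQ W W' V) :
    W'.emb ⟶ V.emb := EmbS.incl c.k' c.str_k'

end Bordisms

/-! ## Algebras with twists -/

section Twists

/-- Objects: `R`-algebras. -/
structure ModT (R : Type v) [CommRing R] where
  carrier : Type v
  [ring : Ring carrier]
  [algebra : Algebra R carrier]

attribute [instance] ModT.ring ModT.algebra

variable {R : Type v} [CommRing R]

/-- The tensor product of two algebras. -/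
abbrev ModT.tensor (M N : ModT R) : ModT R := ⟨M.carrier ⊗[R] N.carrier⟩

/-- 1-morphisms: `R`-linear maps. -/
def OneHom (M N : ModT R) : Type v := M.carrier →ₗ[R] N.carrier

/-- A decomposition `f = mod ∘ alg` through an algebra `L`, with `alg` an algebra homomorphism and
`mod` an `R`-linear map. -/
structure Fact {M N : ModT R} (f : OneHom M N) where
  L : ModT R
  alg : M.carrier →ₐ[R] L.carrier
  mod : L.carrier →ₗ[R] N.carrier
  fac : mod ∘ₗ alg.toLinearMap = f

/-- The maps `α^alg`, `α^mod` of an immediate twist between two given decompositions. -/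
structure FactHom {M N : ModT R} {f g : OneHom M N} (x : Fact f) (y : Fact g) where
  αAlg : x.L.carrier →ₐ[R] y.L.carrier
  αMod : y.L.carrier →ₗ[R] x.L.carrier
  alg_eq : αAlg.comp x.alg = y.alg
  mod_eq : x.mod ∘ₗ αMod = y.mod

/-- The immediate twist obtained by composing two immediate twists through the same decomposition of
the middle map. -/
def FactHom.comp {M N : ModT R} {f g h : OneHom M N} {x : Fact f} {y : Fact g} {z : Fact h}
    (S : FactHom x y) (T : FactHom y z) : FactHom x z where
  αAlg := T.αAlg.comp S.αAlg
  αMod := S.αMod ∘ₗ T.αMod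
  alg_eq := by rw [AlgHom.comp_assoc, S.alg_eq, T.alg_eq]
  mod_eq := by rw [← LinearMap.comp_assoc, S.mod_eq, T.mod_eq]

/-- An immediate twist from `f` to `g`. -/
structure ImmTwist {M N : ModT R} (f g : OneHom M N) where
  src : Fact f
  tgt : Fact g
  hom : FactHom src tgt

instance (M N : ModT R) : Quiver (OneHom M N) where
  Hom := ImmTwist

/-- An immediate twist as a sequence of length one. -/
def ImmTwist.path {M N : ModT R} {f g : OneHom M N} (T : ImmTwist f g) :
    (Paths.of (OneHom M N)).obj f ⟶ (Paths.of (OneHom M N)).obj g :=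
  (Paths.of (OneHom M N)).map T

/-- The relations on sequences of immediate twists: two consecutive immediate twists through the same
decomposition of the middle map may be composed, and an immediate twist with inverse `α^alg` and
`α^mod` (a renaming of the middle algebra) is trivial. -/
inductive TwistRel (M N : ModT R) : HomRel (Paths (OneHom M N))
  | merge {f g h : OneHom M N} {x : Fact f} {y : Fact g} {z : Fact h}
      (S : FactHom x y) (T : FactHom y z) :
      TwistRel M N ((ImmTwist.mk x y S).path ≫ (ImmTwist.mk y z T).path)
        (ImmTwist.mk x z (S.comp T)).path
  | trivial {f : OneHom M N} {x y : Fact f} (T : FactHom x y)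
      (h₁ : T.αMod ∘ₗ T.αAlg.toLinearMap = LinearMap.id)
      (h₂ : T.αAlg.toLinearMap ∘ₗ T.αMod = LinearMap.id) :
      TwistRel M N (ImmTwist.mk x y T).path (𝟙 _)

/-- The category of linear maps `M → N` and twists: finite sequences of immediate twists modulo the
relations `TwistRel`, composed by juxtaposition. -/
abbrev TwistCat (M N : ModT R) := CategoryTheory.Quotient (TwistRel M N)

/-- A linear map as an object of the category of twists. -/
abbrev TwistCat.of {M N : ModT R} (f : OneHom M N) : TwistCat M N :=
  ⟨(Paths.of (OneHom M N)).obj f⟩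

/-- 2-morphisms: twists from `f` to `g`. -/
abbrev Twist {M N : ModT R} (f g : OneHom M N) : Type (v + 1) :=
  TwistCat.of f ⟶ TwistCat.of g

/-- The class of an immediate twist. -/
abbrev ImmTwist.cls {M N : ModT R} {f g : OneHom M N} (T : ImmTwist f g) : Twist f g :=
  (CategoryTheory.Quotient.functor (TwistRel M N)).map T.path

/-- The composition of linear maps. -/
abbrev OneHom.comp {M N P : ModT R} (g : OneHom N P) (f : OneHom M N) : OneHom M P :=
  LinearMap.comp (g : N.carrier →ₗ[R] P.carrier) (f : M.carrier →ₗ[R] N.carrier)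

/-- The tensor product of linear maps. -/
abbrev OneHom.tensor {M N M' N' : ModT R} (f : OneHom M N) (f' : OneHom M' N') :
    OneHom (M.tensor M') (N.tensor N') :=
  TensorProduct.map (f : M.carrier →ₗ[R] N.carrier) (f' : M'.carrier →ₗ[R] N'.carrier)

/-- The tensor product of decompositions. -/
def Fact.tensor {M N M' N' : ModT R} {f : OneHom M N} {f' : OneHom M' N'} (x : Fact f)
    (x' : Fact f') : Fact (f.tensor f') where
  L := x.L.tensor x'.L
  alg := Algebra.TensorProduct.map x.alg x'.alg
  mod := TensorProduct.map x.mod x'.mod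
  fac := (TensorProduct.map_comp _ _ _ _).symm.trans
    (congrArg₂ TensorProduct.map x.fac x'.fac)

/-- The tensor product of immediate twists. -/
def ImmTwist.tensor {M N M' N' : ModT R} {f g : OneHom M N} {f' g' : OneHom M' N'}
    (T : ImmTwist f g) (T' : ImmTwist f' g') : ImmTwist (f.tensor f') (g.tensor g') where
  src := T.src.tensor T'.src
  tgt := T.tgt.tensor T'.tgt
  hom :=
    { αAlg := Algebra.TensorProduct.map T.hom.αAlg T'.hom.αAlg
      αMod := TensorProduct.map T.hom.αMod T'.hom.αMod
      alg_eq := (Algebra.TensorProduct.map_comp _ _ _ _).symm.trans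
        (congrArg₂ Algebra.TensorProduct.map T.hom.alg_eq T'.hom.alg_eq)
      mod_eq := (TensorProduct.map_comp _ _ _ _).symm.trans
        (congrArg₂ TensorProduct.map T.hom.mod_eq T'.hom.mod_eq) }

/-- The immediate twists `T` (of maps `M → N`) and `T'` (of maps `M' → N'`) correspond to each other
along linear maps `p : M → M'` and `q : N → N'`: there are linear maps between the middle algebras
making all squares commute. -/
def ImmTwist.Compatible {M N M' N' : ModT R} (p : OneHom M M') (q : OneHom N N')
    {f g : OneHom M N} {f' g' : OneHom M' N'} (T : ImmTwist f g) (T' : ImmTwist f' g') : Prop :=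
  ∃ (u : OneHom T.src.L T'.src.L) (w : OneHom T.tgt.L T'.tgt.L),
    OneHom.comp u T.src.alg.toLinearMap = OneHom.comp T'.src.alg.toLinearMap p ∧
    OneHom.comp w T.tgt.alg.toLinearMap = OneHom.comp T'.tgt.alg.toLinearMap p ∧
    OneHom.comp q T.src.mod = OneHom.comp T'.src.mod u ∧
    OneHom.comp q T.tgt.mod = OneHom.comp T'.tgt.mod w ∧
    OneHom.comp w T.hom.αAlg.toLinearMap = OneHom.comp T'.hom.αAlg.toLinearMap u ∧
    OneHom.comp u T.hom.αMod = OneHom.comp T'.hom.αMod w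

end Twists

/-! ## Topological Quantum Field Theories over `S` -/

section TQFT

variable {m : ℕ}

/-- The data of a lax monoidal 2-functor from bordisms over `S` to `R`-algebras with twists. -/
structure PreTQFT (S : (EmbC m)ᵒᵖ ⥤ Cat.{w₁, w₂}) (R : Type v) [CommRing R] where
  /-- the value on objects -/
  obj : BordObj S → ModT R
  /-- the value on bordisms -/
  map : ∀ {X Y : BordObj S}, Bord X Y → OneHom (obj X) (obj Y)
  /-- the value on 2-morphisms -/
  map₂ : ∀ {X Y : BordObj S} {W W' : Bord X Y}, (W ⟶ W') → Twist (map W) (map W')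
  /-- the unit constraint `R → Z(∅)` -/
  unit : ∀ E : BordObj S, IsEmpty E.mfd.carrier → R →ₗ[R] (obj E).carrier
  /-- the monoidal constraint `Z(X) ⊗ Z(X') → Z(X ⊔ X')` -/
  mu : ∀ {X X' P : BordObj S}, ObjSum X X' P → OneHom ((obj X).tensor (obj X')) (obj P)

/-- A lax monoidal (symmetric) Topological Quantum Field Theory over `S` with values in `R`-algebras
with twists. -/
structure LaxMonoidalTQFT (S : (EmbC m)ᵒᵖ ⥤ Cat.{w₁, w₂}) (R : Type v) [CommRing R]
    extends PreTQFT S R where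
  -- functoriality on 2-morphisms
  map₂_id : ∀ {X Y : BordObj S} (W : Bord X Y), map₂ (𝟙 W) = 𝟙 _
  map₂_comp : ∀ {X Y : BordObj S} {W W' W'' : Bord X Y} (φ : W ⟶ W') (ψ : W' ⟶ W''),
    map₂ (φ ≫ ψ) = map₂ φ ≫ map₂ ψ
  -- functoriality on bordisms
  map_id : ∀ X : BordObj S, map (Bord.id X) = (LinearMap.id : (obj X).carrier →ₗ[R] _)
  map_comp : ∀ {X Y Z : BordObj S} {W : Bord X Y} {W' : Bord Y Z} {P : Bord X Z},
    Bord.Composite W W' P → map P = OneHom.comp (map W') (map W)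
  -- the canonical 2-morphisms between composites (independence of the model of a composite,
  -- associativity, units) go to identities
  map₂_model : ∀ {X Y Z : BordObj S} {W : Bord X Y} {W' : Bord Y Z} {P Q : Bord X Z}
    (c : Bord.Composite W W' P) (d : Bord.Composite W W' Q) (φ : P ⟶ Q),
    c.fst ≫ φ.hom = d.fst → c.snd ≫ φ.hom = d.snd →
    ∃ h : map P = map Q, map₂ φ = eqToHom (congrArg TwistCat.of h)
  map₂_assoc : ∀ {X₁ X₂ X₃ X₄ : BordObj S} {W₁ : Bord X₁ X₂} {W₂ : Bord X₂ X₃} {W₃ : Bord X₃ X₄}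
    {W₁₂ : Bord X₁ X₃} {W₂₃ : Bord X₂ X₄} {P Q : Bord X₁ X₄} (c₁₂ : Bord.Composite W₁ W₂ W₁₂)
    (c₂₃ : Bord.Composite W₂ W₃ W₂₃) (c : Bord.Composite W₁₂ W₃ P) (d : Bord.Composite W₁ W₂₃ Q)
    (φ : P ⟶ Q), c₁₂.fst ≫ c.fst ≫ φ.hom = d.fst → c₁₂.snd ≫ c.fst ≫ φ.hom = c₂₃.fst ≫ d.snd →
    c.snd ≫ φ.hom = c₂₃.snd ≫ d.snd →
    ∃ h : map P = map Q, map₂ φ = eqToHom (congrArg TwistCat.of h)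
  map₂_id_left : ∀ {X Y : BordObj S} {W P : Bord X Y} (c : Bord.Composite (Bord.id X) W P)
    (φ : P ⟶ W), c.snd ≫ φ.hom = 𝟙 _ →
    ∃ h : map P = map W, map₂ φ = eqToHom (congrArg TwistCat.of h)
  map₂_id_right : ∀ {X Y : BordObj S} {W P : Bord X Y} (c : Bord.Composite W (Bord.id Y) P)
    (φ : P ⟶ W), c.fst ≫ φ.hom = 𝟙 _ →
    ∃ h : map P = map W, map₂ φ = eqToHom (congrArg TwistCat.of h)
  -- compatibility with horizontal composition of a 2-morphism with a bordism on either side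
  map₂_whisker_left : ∀ {X Y Z : BordObj S} {W W₁ : Bord X Y} {W' : Bord Y Z} {P P₁ : Bord X Z}
    (c : Bord.Composite W W' P) (c₁ : Bord.Composite W₁ W' P₁) (φ : W ⟶ W₁) (ψ : P ⟶ P₁),
    c.fst ≫ ψ.hom = φ.hom ≫ c₁.fst → c.snd ≫ ψ.hom = c₁.snd →
    ∃ (T : ImmTwist (map W) (map W₁)) (T' : ImmTwist (map P) (map P₁)),
      T.cls = map₂ φ ∧ T'.cls = map₂ ψ ∧ T.Compatible LinearMap.id (map W') T'
  map₂_whisker_right : ∀ {X Y Z : BordObj S} {W : Bord X Y} {W' W₁' : Bord Y Z} {P P₁ : Bord X Z}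
    (c : Bord.Composite W W' P) (c₁ : Bord.Composite W W₁' P₁) (φ : W' ⟶ W₁') (ψ : P ⟶ P₁),
    c.fst ≫ ψ.hom = c₁.fst → c.snd ≫ ψ.hom = φ.hom ≫ c₁.snd →
    ∃ (T : ImmTwist (map W') (map W₁')) (T' : ImmTwist (map P) (map P₁)),
      T.cls = map₂ φ ∧ T'.cls = map₂ ψ ∧ T'.Compatible (map W) LinearMap.id T
  -- naturality of the monoidal constraint, for bordisms and for 2-morphisms
  mu_natural : ∀ {X X' P Y Y' Q : BordObj S} {hP : ObjSum X X' P} {hQ : ObjSum Y Y' Q}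
    {W : Bord X Y} {W' : Bord X' Y'} {V : Bord P Q}, BordSum hP hQ W W' V →
    OneHom.comp (map V) (mu hP) = OneHom.comp (mu hQ) ((map W).tensor (map W'))
  mu_natural₂ : ∀ {X X' P Y Y' Q : BordObj S} {hP : ObjSum X X' P} {hQ : ObjSum Y Y' Q}
    {W W₁ : Bord X Y} {W' W₁' : Bord X' Y'} {V V₁ : Bord P Q} (c : BordSum hP hQ W W' V)
    (c₁ : BordSum hP hQ W₁ W₁' V₁) (φ : W ⟶ W₁) (φ' : W' ⟶ W₁') (ψ : V ⟶ V₁),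
    c.inl ≫ ψ.hom = φ.hom ≫ c₁.inl → c.inr ≫ ψ.hom = φ'.hom ≫ c₁.inr →
    ∃ (T : ImmTwist (map W) (map W₁)) (T' : ImmTwist (map W') (map W₁'))
      (U : ImmTwist (map V) (map V₁)), T.cls = map₂ φ ∧ T'.cls = map₂ φ' ∧ U.cls = map₂ ψ ∧
      (T.tensor T').Compatible (mu hP) (mu hQ) U
  -- unitality, associativity and symmetry of the monoidal constraint
  mu_unit_left : ∀ {E X : BordObj S} (hE : IsEmpty E.mfd.carrier) (h : ObjSum E X X),
    h.e' = 𝟙 _ → ∀ (r : R) (z : (obj X).carrier), (mu h).toFun (unit E hE r ⊗ₜ z) = r • z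
  mu_unit_right : ∀ {E X : BordObj S} (hE : IsEmpty E.mfd.carrier) (h : ObjSum X E X),
    h.e = 𝟙 _ → ∀ (r : R) (z : (obj X).carrier), (mu h).toFun (z ⊗ₜ unit E hE r) = r • z
  mu_assoc : ∀ {X₁ X₂ X₃ P₁₂ P₂₃ P : BordObj S} (h₁₂ : ObjSum X₁ X₂ P₁₂) (h₂₃ : ObjSum X₂ X₃ P₂₃)
    (h : ObjSum P₁₂ X₃ P) (k : ObjSum X₁ P₂₃ P), h₁₂.e ≫ h.e = k.e →
    h₁₂.e' ≫ h.e = h₂₃.e ≫ k.e' → h.e' = h₂₃.e' ≫ k.e' →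
    ∀ (z₁ : (obj X₁).carrier) (z₂ : (obj X₂).carrier) (z₃ : (obj X₃).carrier),
      (mu h).toFun ((mu h₁₂).toFun (z₁ ⊗ₜ z₂) ⊗ₜ z₃) = (mu k).toFun (z₁ ⊗ₜ (mu h₂₃).toFun (z₂ ⊗ₜ z₃))
  mu_symm : ∀ {X X' P : BordObj S} (h : ObjSum X X' P) (z : (obj X).carrier)
    (z' : (obj X').carrier), (mu h.swap).toFun (z' ⊗ₜ z) = (mu h).toFun (z ⊗ₜ z')

end TQFT

/-! ## `C`-algebras, field theory and quantisation -/

section CAlgebras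

variable {C : Type u₁} [Category.{u₂} C]

/-- The ring `A(a)`. -/
def Fib (A : Cᵒᵖ ⥤ CommRingCat.{v}) (a : C) : Type v := A.obj (op a)

instance (A : Cᵒᵖ ⥤ CommRingCat.{v}) (a : C) : CommRing (Fib A a) :=
  inferInstanceAs (CommRing (A.obj (op a)))

/-- The map `f^* = A(f)`. -/
def pullRing (A : Cᵒᵖ ⥤ CommRingCat.{v}) {a b : C} (f : a ⟶ b) : Fib A b →+* Fib A a :=
  (A.map f.op).hom

variable [HasTerminal C]

/-- The base ring `A(⋆)`, for `⋆` the final object. -/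
def Base (A : Cᵒᵖ ⥤ CommRingCat.{v}) : Type v := A.obj (op (⊤_ C))

instance (A : Cᵒᵖ ⥤ CommRingCat.{v}) : CommRing (Base A) :=
  inferInstanceAs (CommRing (A.obj (op (⊤_ C))))

/-- `A(a)` is an `A(⋆)`-algebra through the map `a ⟶ ⋆`. -/
instance (A : Cᵒᵖ ⥤ CommRingCat.{v}) (a : C) : Algebra (Base A) (Fib A a) :=
  RingHom.toAlgebra (pullRing A (terminal.from a) : Fib A (⊤_ C) →+* Fib A a)

/-- The map `f^* = A(f)` as a homomorphism of `A(⋆)`-algebras. -/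
def pullAlg (A : Cᵒᵖ ⥤ CommRingCat.{v}) {a b : C} (f : a ⟶ b) : Fib A b →ₐ[Base A] Fib A a where
  __ := pullRing A f
  commutes' r := by
    have h : pullRing A (terminal.from a) = (pullRing A f).comp (pullRing A (terminal.from b)) := by
      rw [← terminal.comp_from f]
      unfold pullRing
      rw [op_comp, A.map_comp]
      rfl
    exact (DFunLike.congr_fun h r).symm

/-- A `C`-algebra: a contravariant functor `A` to commutative rings, `A(f) = f^*`, and a covariant
functor to `A(⋆)`-modules with the same values on objects, `f ↦ f_!`, subject to base change and
to the naturality of the external product `z ⊠ w = p₁^*(z) p₂^*(w)` with respect to `f_!`. -/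
structure CAlgebra (C : Type u₁) [Category.{u₂} C] [HasTerminal C] where
  A : Cᵒᵖ ⥤ CommRingCat.{v}
  push : ∀ {a b : C}, (a ⟶ b) → (Fib A a →ₗ[Base A] Fib A b)
  push_id : ∀ a : C, push (𝟙 a) = LinearMap.id
  push_comp : ∀ {a b c : C} (f : a ⟶ b) (g : b ⟶ c), push (f ≫ g) = push g ∘ₗ push f
  base_change : ∀ {d a₁ a₂ b : C} {g' : d ⟶ a₁} {f' : d ⟶ a₂} {f : a₁ ⟶ b} {g : a₂ ⟶ b},
    IsPullback g' f' f g → ∀ z : Fib A a₁, pullAlg A g (push f z) = push f' (pullAlg A g' z)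
  external : ∀ {a b a' b' p p' : C} {p₁ : p ⟶ a} {p₂ : p ⟶ b} {p₁' : p' ⟶ a'} {p₂' : p' ⟶ b'},
    Nonempty (IsLimit (BinaryFan.mk p₁ p₂)) → Nonempty (IsLimit (BinaryFan.mk p₁' p₂')) →
    ∀ (f : a ⟶ a') (g : b ⟶ b') (h : p ⟶ p'), h ≫ p₁' = p₁ ≫ f → h ≫ p₂' = p₂ ≫ g →
    ∀ (z : Fib A a) (w : Fib A b), push h (pullAlg A p₁ z * pullAlg A p₂ w) =
      pullAlg A p₁' (push f z) * pullAlg A p₂' (push g w)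

namespace CAlgebra

variable (𝒜 : CAlgebra.{u₁, u₂, v} C)

/-- The base ring `𝒜_⋆`. -/
abbrev base : Type v := Base 𝒜.A

/-- The algebra `𝒜_a`. -/
abbrev at' (a : C) : ModT 𝒜.base := ⟨Fib 𝒜.A a⟩

theorem pullAlg_comp {a b c : C} (f : a ⟶ b) (g : b ⟶ c) :
    (pullAlg 𝒜.A f).comp (pullAlg 𝒜.A g) = pullAlg 𝒜.A (f ≫ g) := by
  refine AlgHom.ext fun z => ?_
  have h : pullRing 𝒜.A (f ≫ g) = (pullRing 𝒜.A f).comp (pullRing 𝒜.A g) := by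
    unfold pullRing
    rw [op_comp, 𝒜.A.map_comp]
    rfl
  exact (DFunLike.congr_fun h z).symm

end CAlgebra

/-- Spans `a ← d → b` in `C`. -/
abbrev SpanIn (a b : C) := Span (⊤ : MorphismProperty C) (⊤ : MorphismProperty C) a b

/-- The decomposition `g_! ∘ f^*` associated with a span. -/
def quantFact (𝒜 : CAlgebra.{u₁, u₂, v} C) {a b : C} (s : SpanIn a b) :
    Fact (M := 𝒜.at' a) (N := 𝒜.at' b) (𝒜.push s.r ∘ₗ (pullAlg 𝒜.A s.l).toLinearMap) where
  L := 𝒜.at' s.apex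
  alg := pullAlg 𝒜.A s.l
  mod := 𝒜.push s.r
  fac := rfl

/-- Quantisation on 1-morphisms: a span `a ←f- d -g→ b` goes to `g_! ∘ f^*`. -/
def quant (𝒜 : CAlgebra.{u₁, u₂, v} C) {a b : C} (s : SpanIn a b) :
    OneHom (𝒜.at' a) (𝒜.at' b) :=
  𝒜.push s.r ∘ₗ (pullAlg 𝒜.A s.l).toLinearMap

/-- Quantisation on 2-morphisms: a 2-morphism `s ⇒ s'` of spans, that is a morphism `α` from the apex
of `s'` to the apex of `s` over both ends, goes to the immediate twist given by `α^*` and `α_!`. -/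
def quant₂ (𝒜 : CAlgebra.{u₁, u₂, v} C) {a b : C} {s s' : SpanIn a b} (α : s' ⟶ s) :
    ImmTwist (quant 𝒜 s) (quant 𝒜 s') where
  src := quantFact 𝒜 s
  tgt := quantFact 𝒜 s'
  hom :=
    { αAlg := pullAlg 𝒜.A α.hom
      αMod := 𝒜.push α.hom
      alg_eq := by
        change (pullAlg 𝒜.A α.hom).comp (pullAlg 𝒜.A s.l) = pullAlg 𝒜.A s'.l
        rw [𝒜.pullAlg_comp, Span.Hom.hom_l]
      mod_eq := by
        change 𝒜.push s.r ∘ₗ 𝒜.push α.hom = 𝒜.push s'.r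
        rw [← 𝒜.push_comp, Span.Hom.hom_r] }

variable {m : ℕ} {S : (EmbC m)ᵒᵖ ⥤ Cat.{w₁, w₂}}

/-- Field theory on objects. -/
abbrev fieldObj (F : (EmbS S)ᵒᵖ ⥤ C) (X : BordObj S) : C := F.obj (op X.emb)

/-- Field theory on 1-morphisms: a bordism `W : X ⟶ Y` goes to the span `F(X) ← F(W) → F(Y)`. -/
def field (F : (EmbS S)ᵒᵖ ⥤ C) {X Y : BordObj S} (W : Bord X Y) :
    SpanIn (fieldObj F X) (fieldObj F Y) where
  apex := F.obj (op W.emb)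
  l := F.map W.innEmb.op
  r := F.map W.outEmb.op
  wl := trivial
  wr := trivial

/-- Field theory on 2-morphisms. -/
def field₂ (F : (EmbS S)ᵒᵖ ⥤ C) {X Y : BordObj S} {W W' : Bord X Y} (φ : W ⟶ W') :
    field F W' ⟶ field F W where
  hom := F.map φ.hom.op
  hom_l := by
    change F.map φ.hom.op ≫ F.map W.innEmb.op = F.map W'.innEmb.op
    rw [← F.map_comp, ← op_comp, φ.inn]
  hom_r := by
    change F.map φ.hom.op ≫ F.map W.outEmb.op = F.map W'.outEmb.op
    rw [← F.map_comp, ← op_comp, φ.out]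

/-- The composition of the field theory of `F` with the quantisation of `𝒜`. The monoidal constraint
is the external product, `z ⊗ z' ↦ F(i)^*(z) F(i')^*(z')` for the inclusions `i`, `i'` of the
summands. -/
def pushPull (F : (EmbS S)ᵒᵖ ⥤ C) (𝒜 : CAlgebra.{u₁, u₂, v} C) : PreTQFT S 𝒜.base where
  obj X := 𝒜.at' (fieldObj F X)
  map W := quant 𝒜 (field F W)
  map₂ φ := (quant₂ 𝒜 (field₂ F φ)).cls
  unit E _ := Algebra.linearMap 𝒜.base (Fib 𝒜.A (fieldObj F E))
  mu h := (Algebra.TensorProduct.productMap (pullAlg 𝒜.A (F.map h.inl.op))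
    (pullAlg 𝒜.A (F.map h.inr.op))).toLinearMap

end CAlgebras

end PushPull

end

/-!
The field theory `F` turns geometry into limits, and the quantisation turns limits into identities
between linear maps.

* A composite of bordisms is a gluing, so by the Seifert-van Kampen property `F` sends it to a fibre
  product (`Bord.Composite.isPullback`), that is, to a composite of spans. Base change in `𝒜` moves
  `F(W'.inn)^*` past `F(W.out)_!` and gives `Z(P) = Z(W') ∘ Z(W)`.
* A disjoint union is a gluing along the empty closed manifold. The empty covering shows that the
  empty manifold carries only one structure, so this gluing makes sense over `S`; as `F(∅)` is final,
  `F` sends disjoint unions to products (`SeifertVanKampen.isLimit_of_disjoint`). Naturality of the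
  monoidal constraint is then the compatibility of `f_!` with external products.
* The canonical 2-morphisms between composites compare two constructions of the same limit, hence `F`
  inverts them. For an invertible `f`, base change along squares made of `f` and identities shows
  that `f^*` and `f_!` are mutually inverse, so the corresponding twist is trivial
  (`quant₂_cls_of_isIso`). This uses no inverse of the 2-morphism itself, whose component in `S`
  is not assumed to be invertible.
* Changing one factor of a composite by a 2-morphism gives a square which is a pullback by the pasting
  lemma. The middle algebras then correspond by pullback, from a first factor to the composite, or by
  pushforward, from the composite to a second factor; base change gives the compatibility with
  `α^mod` in the first case and with `α^alg` in the second.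
-/

namespace PushPull

/-! ### Embeddings with structure -/

section Structures

variable {m : ℕ} {S : (EmbC m)ᵒᵖ ⥤ Cat.{w₁, w₂}}

theorem restr_comp_obj {M N P : CompactManifold m} (f : M ⟶ N) (g : N ⟶ P) (r : Str S P) :
    (restr S (f ≫ g)).obj r = (restr S f).obj ((restr S g).obj r) :=
  (EmbS.map_comp_obj (cls f) (cls g) r).symm

theorem EmbS.incl_comp {M N P : CompactManifold m} (f : M ⟶ N) (g : N ⟶ P) {k : M ⟶ P}
    (hk : f ≫ g = k) {s : Str S M} {t : Str S N} {r : Str S P} (hf : (restr S f).obj t = s)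
    (hg : (restr S g).obj r = t) (h : (restr S k).obj r = s) :
    EmbS.incl f hf ≫ EmbS.incl g hg = EmbS.incl k h := by
  subst hk
  refine EmbS.Hom.ext' rfl ?_
  change (eqToHom hf.symm ≫ (S.map (cls f).op).toFunctor.map (eqToHom hg.symm) ≫
    eqToHom (EmbS.map_comp_obj (cls f) (cls g) r)) ≫ eqToHom rfl = eqToHom h.symm
  simp only [eqToHom_map, eqToHom_trans]
  rfl

theorem EmbS.incl_id {M : CompactManifold m} (s : Str S M) (h : (restr S (𝟙 M)).obj s = s) :
    EmbS.incl (𝟙 M) h = 𝟙 (EmbS.of M s) :=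
  EmbS.Hom.ext' rfl (Category.comp_id _)

/-- A commuting square of underlying embeddings gives one of embeddings with structure. -/
theorem EmbS.incl_comp_eq {M N N' P : CompactManifold m} {f : M ⟶ N} {g : N ⟶ P} {f' : M ⟶ N'}
    {g' : N' ⟶ P} (hk : f ≫ g = f' ≫ g') {s : Str S M} {t : Str S N} {t' : Str S N'} {r : Str S P}
    (hf : (restr S f).obj t = s) (hg : (restr S g).obj r = t)
    (hf' : (restr S f').obj t' = s) (hg' : (restr S g').obj r = t') :
    EmbS.incl f hf ≫ EmbS.incl g hg = EmbS.incl f' hf' ≫ EmbS.incl g' hg' := by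
  have h : (restr S (f ≫ g)).obj r = s := by rw [restr_comp_obj, hg, hf]
  rw [EmbS.incl_comp f g rfl hf hg h, EmbS.incl_comp f' g' hk.symm hf' hg' h]

/-- A manifold with empty underlying space carries at most one structure: apply the sheaf condition
to the empty covering. -/
theorem IsSheaf.str_eq_of_isEmpty (hS : IsSheaf S) {M : CompactManifold m} [IsEmpty M.carrier]
    (s t : Str S M) : s = t := by
  let c : ClosedCover M :=
    { ι := Empty
      W := Empty.elim
      j := fun i => i.elim
      covers := fun x => isEmptyElim x
      V := fun i => i.elim
      p := fun i => i.elim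
      q := fun i => i.elim
      comm := fun i => i.elim
      inter := fun i => i.elim }
  exact (hS.glue_obj c (fun i => i.elim) (fun i => i.elim)).unique (fun i => i.elim)
    (fun i => i.elim)

/-- The empty closed manifold. -/
def ClosedManifold.empty (m : ℕ) : ClosedManifold m :=
  letI : ChartedSpace (EuclideanSpace ℝ (Fin m)) Empty := ChartedSpace.empty _ _
  { carrier := Empty }

instance (m : ℕ) : IsEmpty (ClosedManifold.empty m).carrier := inferInstanceAs (IsEmpty Empty)

instance (m : ℕ) : IsEmpty (ClosedManifold.empty m).collar.carrier :=
  inferInstanceAs (IsEmpty ((ClosedManifold.empty m).carrier × unitInterval))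

/-- The embedding of an empty manifold. -/
def TameEmb.ofIsEmpty (M N : CompactManifold m) [IsEmpty M.carrier] : M ⟶ N :=
  TameEmb.mk (fun x => isEmptyElim x) (fun x => isEmptyElim x) (fun x => isEmptyElim x)
    (fun x => isEmptyElim x) (fun x => isEmptyElim x) (fun x => isEmptyElim x)

/-- A disjoint union is a gluing along the empty closed manifold. -/
theorem IsGluing.of_disjoint {W₁ W₂ P : CompactManifold m} {j₁ : W₁ ⟶ P} {j₂ : W₂ ⟶ P}
    (hc : Set.range j₁.toFun ∪ Set.range j₂.toFun = Set.univ)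
    (hd : Disjoint (Set.range j₁.toFun) (Set.range j₂.toFun)) :
    IsGluing (TameEmb.ofIsEmpty (ClosedManifold.empty m).collar W₁)
      (TameEmb.ofIsEmpty (ClosedManifold.empty m).collar W₂) j₁ j₂ where
  bd₁ x := isEmptyElim x
  bd₂ x := isEmptyElim x
  comm := TameEmb.ext (funext fun x => isEmptyElim x)
  covers := hc
  inter := by rw [hd.inter_eq]; exact Set.empty_subset _

/-- A functor with the Seifert-van Kampen property sends disjoint unions to products. -/
theorem SeifertVanKampen.isLimit_of_disjoint {C : Type u₁} [Category.{u₂} C]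
    {F : (EmbS S)ᵒᵖ ⥤ C} (hF : SeifertVanKampen F) (hS : IsSheaf S)
    {W₁ W₂ P : CompactManifold m} {j₁ : W₁ ⟶ P} {j₂ : W₂ ⟶ P}
    (hc : Set.range j₁.toFun ∪ Set.range j₂.toFun = Set.univ)
    (hd : Disjoint (Set.range j₁.toFun) (Set.range j₂.toFun))
    {s₁ : Str S W₁} {s₂ : Str S W₂} {s : Str S P}
    (k₁ : (restr S j₁).obj s = s₁) (k₂ : (restr S j₂).obj s = s₂) :
    Nonempty (IsLimit (BinaryFan.mk (F.map (EmbS.incl j₁ k₁).op) (F.map (EmbS.incl j₂ k₂).op))) := by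
  have sq := hF.gluing (IsGluing.of_disjoint hc hd) rfl (hS.str_eq_of_isEmpty _ _) k₁ k₂
  obtain ⟨hT⟩ := hF.empty (ClosedManifold.empty m).collar
    ((restr S (TameEmb.ofIsEmpty (ClosedManifold.empty m).collar W₁)).obj s₁) inferInstance
  exact ⟨isProductOfIsTerminalIsPullback _ _ _ _ hT sq.isLimit⟩

section Sums

variable {X X' P Y Y' Q : BordObj S} {hP : ObjSum X X' P} {hQ : ObjSum Y Y' Q}
  {W : Bord X Y} {W' : Bord X' Y'} {V : Bord P Q} {C : Type u₁} [Category.{u₂} C]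
  {F : (EmbS S)ᵒᵖ ⥤ C}

theorem ObjSum.isLimit (hF : SeifertVanKampen F) (hS : IsSheaf S) (h : ObjSum X X' P) :
    Nonempty (IsLimit (BinaryFan.mk (F.map h.inl.op) (F.map h.inr.op))) := by
  refine hF.isLimit_of_disjoint hS ?_ ?_ _ _
  · refine Set.eq_univ_of_forall fun ⟨x, t⟩ => ?_
    rcases h.covers.ge (Set.mem_univ x) with ⟨y, hy⟩ | ⟨y, hy⟩
    · exact Or.inl ⟨(y, t), (h.e_eq y t).trans (Prod.ext hy rfl)⟩
    · exact Or.inr ⟨(y, t), (h.e_eq' y t).trans (Prod.ext hy rfl)⟩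
  · rw [Set.disjoint_left]
    rintro _ ⟨⟨y, t⟩, rfl⟩ ⟨⟨z, r⟩, hz⟩
    have hz' := congrArg Prod.fst ((h.e_eq' z r).symm.trans (hz.trans (h.e_eq y t)))
    exact Set.disjoint_left.1 h.disjoint ⟨y, rfl⟩ ⟨z, hz'⟩

theorem BordSum.isLimit (hF : SeifertVanKampen F) (hS : IsSheaf S) (c : BordSum hP hQ W W' V) :
    Nonempty (IsLimit (BinaryFan.mk (F.map c.inl.op) (F.map c.inr.op))) :=
  hF.isLimit_of_disjoint hS c.covers c.disjoint _ _

end Sums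

end Structures

/-! ### Identities between twists -/

section Twists

variable {R : Type v} [CommRing R] {M N : ModT R}

/-- An immediate twist whose two maps are mutually inverse forces its source and target to be equal,
and is the identity up to this equality. -/
theorem ImmTwist.cls_eq_eqToHom {f g : OneHom M N} (T : ImmTwist f g)
    (h₁ : T.hom.αMod ∘ₗ T.hom.αAlg.toLinearMap = LinearMap.id)
    (h₂ : T.hom.αAlg.toLinearMap ∘ₗ T.hom.αMod = LinearMap.id) :
    ∃ h : f = g, T.cls = eqToHom (congrArg TwistCat.of h) := by
  obtain ⟨x, y, T⟩ := T
  have h : f = g := by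
    have e : x.mod ∘ₗ (T.αMod ∘ₗ T.αAlg.toLinearMap) ∘ₗ x.alg.toLinearMap =
        y.mod ∘ₗ y.alg.toLinearMap := by
      rw [← T.mod_eq, ← T.alg_eq]
      rfl
    rw [h₁] at e
    exact x.fac.symm.trans (e.trans y.fac)
  subst h
  exact ⟨rfl, CategoryTheory.Quotient.sound _ (TwistRel.trivial T h₁ h₂)⟩

theorem FactHom.ext_maps {f g : OneHom M N} {x : Fact f} {y : Fact g} {S T : FactHom x y}
    (h : S.αAlg = T.αAlg) (h' : S.αMod = T.αMod) : S = T := by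
  obtain ⟨_, _, _, _⟩ := S
  obtain ⟨_, _, _, _⟩ := T
  dsimp at h h'
  subst h h'
  rfl

theorem ImmTwist.cls_comp {f g h : OneHom M N} {x : Fact f} {y : Fact g} {z : Fact h}
    (S : FactHom x y) (T : FactHom y z) :
    (ImmTwist.mk x y S).cls ≫ (ImmTwist.mk y z T).cls = (ImmTwist.mk x z (S.comp T)).cls :=
  CategoryTheory.Quotient.sound _ (TwistRel.merge S T)

end Twists

/-! ### Push and pull -/

section CAlgebras

variable {C : Type u₁} [Category.{u₂} C]

/-- A comparison map between two ways of forming a triple fibre product is invertible. -/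
theorem isIso_of_isPullback_assoc {w₁ w₂ w₃ y₂ y₃ p₁₂ p₂₃ p q : C} {r₁ : w₁ ⟶ y₂} {l₂ : w₂ ⟶ y₂}
    {r₂ : w₂ ⟶ y₃} {l₃ : w₃ ⟶ y₃} {a₁ : p₁₂ ⟶ w₁} {a₂ : p₁₂ ⟶ w₂} {b₂ : p₂₃ ⟶ w₂}
    {b₃ : p₂₃ ⟶ w₃} {c : p ⟶ p₁₂} {c₃ : p ⟶ w₃} {d₁ : q ⟶ w₁} {d : q ⟶ p₂₃}
    (h₁₂ : IsPullback a₁ a₂ r₁ l₂) (h₂₃ : IsPullback b₂ b₃ r₂ l₃)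
    (hp : IsPullback c c₃ (a₂ ≫ r₂) l₃) (hq : IsPullback d₁ d r₁ (b₂ ≫ l₂))
    (φ : q ⟶ p) (e₁ : φ ≫ c ≫ a₁ = d₁) (e₂ : φ ≫ c ≫ a₂ = d ≫ b₂) (e₃ : φ ≫ c₃ = d ≫ b₃) :
    IsIso φ := by
  let t : p ⟶ p₂₃ := h₂₃.lift (c ≫ a₂) c₃ (by rw [Category.assoc, hp.w])
  have t₂ : t ≫ b₂ = c ≫ a₂ := h₂₃.lift_fst _ _ _
  have t₃ : t ≫ b₃ = c₃ := h₂₃.lift_snd _ _ _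
  let ψ : p ⟶ q := hq.lift (c ≫ a₁) t (by rw [← Category.assoc, t₂, Category.assoc, h₁₂.w,
    Category.assoc])
  have ψ₁ : ψ ≫ d₁ = c ≫ a₁ := hq.lift_fst _ _ _
  have ψ₂ : ψ ≫ d = t := hq.lift_snd _ _ _
  refine ⟨ψ, hq.hom_ext ?_ (h₂₃.hom_ext ?_ ?_), hp.hom_ext (h₁₂.hom_ext ?_ ?_) ?_⟩
  · simp [ψ₁, e₁]
  · simp [ψ₂, t₂, e₂]
  · simp [ψ₂, t₃, e₃]
  · simp [e₁, ψ₁]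
  · simp only [Category.assoc, e₂, reassoc_of% ψ₂, t₂, Category.id_comp]
  · simp only [Category.assoc, e₃, reassoc_of% ψ₂, t₃, Category.id_comp]

variable [HasTerminal C]

namespace CAlgebra

variable (𝒜 : CAlgebra.{u₁, u₂, v} C)

theorem pullAlg_pullAlg {a b c : C} {f : a ⟶ b} {g : b ⟶ c} {k : a ⟶ c} (h : f ≫ g = k)
    (z : Fib 𝒜.A c) : pullAlg 𝒜.A f (pullAlg 𝒜.A g z) = pullAlg 𝒜.A k z := by
  rw [← h, ← 𝒜.pullAlg_comp]
  rfl

theorem push_push {a b c : C} {f : a ⟶ b} {g : b ⟶ c} {k : a ⟶ c} (h : f ≫ g = k)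
    (z : Fib 𝒜.A a) : 𝒜.push g (𝒜.push f z) = 𝒜.push k z := by
  rw [← h, 𝒜.push_comp]
  rfl

theorem pullAlg_id_apply (a : C) (z : Fib 𝒜.A a) : pullAlg 𝒜.A (𝟙 a) z = z := by
  change (𝒜.A.map (𝟙 a).op).hom z = z
  rw [op_id, 𝒜.A.map_id]
  rfl

theorem push_id_apply (a : C) (z : Fib 𝒜.A a) : 𝒜.push (𝟙 a) z = z := by
  rw [𝒜.push_id]
  rfl

/-- Base change along the kernel pair of a monomorphism, which is trivial. -/
theorem pullAlg_push_of_mono {a b : C} (f : a ⟶ b) [Mono f] (z : Fib 𝒜.A a) :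
    pullAlg 𝒜.A f (𝒜.push f z) = z := by
  rw [𝒜.base_change (IsKernelPair.id_of_mono f) z, push_id_apply, pullAlg_id_apply]

/-- Base change along the square with two sides `f` and two identities. -/
theorem push_pullAlg_of_isIso {a b : C} (f : a ⟶ b) [IsIso f] (z : Fib 𝒜.A b) :
    𝒜.push f (pullAlg 𝒜.A f z) = z := by
  have h : IsPullback f f (𝟙 b) (𝟙 b) := IsPullback.of_vert_isIso ⟨by simp⟩
  rw [← 𝒜.base_change h z, push_id_apply, pullAlg_id_apply]

end CAlgebra

variable (𝒜 : CAlgebra.{u₁, u₂, v} C) {a b : C}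

/-- The quantisation of an invertible 2-morphism of spans is trivial. -/
theorem quant₂_cls_of_isIso {s s' : SpanIn a b} (α : s' ⟶ s) [IsIso α.hom] :
    ∃ h : quant 𝒜 s = quant 𝒜 s', (quant₂ 𝒜 α).cls = eqToHom (congrArg TwistCat.of h) :=
  ImmTwist.cls_eq_eqToHom _ (LinearMap.ext fun z => 𝒜.push_pullAlg_of_isIso α.hom z)
    (LinearMap.ext fun z => 𝒜.pullAlg_push_of_mono α.hom z)

end CAlgebras

/-! ### The field theory followed by the quantisation -/

section PushPull

variable {m : ℕ} {S : (EmbC m)ᵒᵖ ⥤ Cat.{w₁, w₂}} {C : Type u₁} [Category.{u₂} C]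
  {F : (EmbS S)ᵒᵖ ⥤ C}

theorem map_op_comp (F : (EmbS S)ᵒᵖ ⥤ C) {X Y Z : EmbS S} {f : X ⟶ Y} {g : Y ⟶ Z} {k : X ⟶ Z}
    (h : f ≫ g = k) : F.map g.op ≫ F.map f.op = F.map k.op := by
  rw [← F.map_comp, ← op_comp, h]

theorem map_op_square (F : (EmbS S)ᵒᵖ ⥤ C) {X Y Y' Z : EmbS S} {f : X ⟶ Y} {g : Y ⟶ Z}
    {f' : X ⟶ Y'} {g' : Y' ⟶ Z} (h : f ≫ g = f' ≫ g') :
    F.map g.op ≫ F.map f.op = F.map g'.op ≫ F.map f'.op := by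
  rw [map_op_comp F h, map_op_comp F rfl]

theorem map_id_innEmb (F : (EmbS S)ᵒᵖ ⥤ C) (X : BordObj S) :
    F.map (Bord.id X).innEmb.op = 𝟙 (F.obj (op X.emb)) :=
  (congrArg (fun f : X.emb ⟶ X.emb => F.map f.op) (EmbS.incl_id _ _)).trans (F.map_id _)

theorem map_id_outEmb (F : (EmbS S)ᵒᵖ ⥤ C) (X : BordObj S) :
    F.map (Bord.id X).outEmb.op = 𝟙 (F.obj (op X.emb)) :=
  (congrArg (fun f : X.emb ⟶ X.emb => F.map f.op) (EmbS.incl_id _ _)).trans (F.map_id _)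

namespace Bord.Composite

variable {X Y Z : BordObj S} {W : Bord X Y} {W' : Bord Y Z} {P : Bord X Z}

theorem innEmb_fst (c : Bord.Composite W W' P) : W.innEmb ≫ c.fst = P.innEmb :=
  EmbS.incl_comp _ _ c.inn _ _ _

theorem outEmb_snd (c : Bord.Composite W W' P) : W'.outEmb ≫ c.snd = P.outEmb :=
  EmbS.incl_comp _ _ c.out _ _ _

theorem isPullback (hF : SeifertVanKampen F) (c : Bord.Composite W W' P) :
    IsPullback (F.map c.fst.op) (F.map c.snd.op) (F.map W.outEmb.op) (F.map W'.innEmb.op) :=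
  hF.gluing c.gluing W.str_out W'.str_inn c.str_j c.str_j'

/-- Changing the first factor of a composite by `φ` gives a pullback square: pasted with the gluing
square of `P` it is the gluing square of `P₁`. -/
theorem isPullback_whisker_left (hF : SeifertVanKampen F) {W₁ : Bord X Y} {P₁ : Bord X Z}
    (c : Bord.Composite W W' P) (c₁ : Bord.Composite W₁ W' P₁) (φ : W ⟶ W₁) (ψ : P ⟶ P₁)
    (e : c.fst ≫ ψ.hom = φ.hom ≫ c₁.fst) (e' : c.snd ≫ ψ.hom = c₁.snd) :
    IsPullback (F.map c₁.fst.op) (F.map ψ.hom.op) (F.map φ.hom.op) (F.map c.fst.op) := by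
  refine IsPullback.of_bot ?_ (map_op_square F e.symm) (c.isPullback hF)
  rw [map_op_comp F e', map_op_comp F φ.out]
  exact c₁.isPullback hF

theorem isPullback_whisker_right (hF : SeifertVanKampen F) {W₁' : Bord Y Z} {P₁ : Bord X Z}
    (c : Bord.Composite W W' P) (c₁ : Bord.Composite W W₁' P₁) (φ : W' ⟶ W₁') (ψ : P ⟶ P₁)
    (e : c.fst ≫ ψ.hom = c₁.fst) (e' : c.snd ≫ ψ.hom = φ.hom ≫ c₁.snd) :
    IsPullback (F.map c₁.snd.op) (F.map ψ.hom.op) (F.map φ.hom.op) (F.map c.snd.op) := by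
  refine IsPullback.of_bot ?_ (map_op_square F e'.symm) (c.isPullback hF).flip
  rw [map_op_comp F e, map_op_comp F φ.inn]
  exact (c₁.isPullback hF).flip

end Bord.Composite

variable [HasTerminal C] (𝒜 : CAlgebra.{u₁, u₂, v} C)

theorem pushPull_map_apply {X Y : BordObj S} (W : Bord X Y) (z : Fib 𝒜.A (fieldObj F X)) :
    ((pushPull F 𝒜).map W).toFun z =
      𝒜.push (F.map W.outEmb.op) (pullAlg 𝒜.A (F.map W.innEmb.op) z) :=
  rfl

/-- A 2-morphism that the field theory makes invertible has trivial quantisation. -/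
theorem pushPull_map₂_of_isIso {X Y : BordObj S} {W W' : Bord X Y} (φ : W ⟶ W')
    (h : IsIso (F.map φ.hom.op)) :
    ∃ h : (pushPull F 𝒜).map W = (pushPull F 𝒜).map W',
      (pushPull F 𝒜).map₂ φ = eqToHom (congrArg TwistCat.of h) :=
  have : IsIso (field₂ F φ).hom := h
  quant₂_cls_of_isIso 𝒜 (field₂ F φ)

theorem pushPull_map₂_id {X Y : BordObj S} (W : Bord X Y) : (pushPull F 𝒜).map₂ (𝟙 W) = 𝟙 _ := by
  obtain ⟨_, h⟩ := pushPull_map₂_of_isIso 𝒜 (𝟙 W) (F := F)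
    (inferInstanceAs (IsIso (F.map (𝟙 W.emb).op)))
  exact h

theorem pushPull_map₂_comp {X Y : BordObj S} {W W' W'' : Bord X Y} (φ : W ⟶ W') (ψ : W' ⟶ W'') :
    (pushPull F 𝒜).map₂ (φ ≫ ψ) = (pushPull F 𝒜).map₂ φ ≫ (pushPull F 𝒜).map₂ ψ := by
  refine Eq.trans ?_ (ImmTwist.cls_comp (quant₂ 𝒜 (field₂ F φ)).hom
    (quant₂ 𝒜 (field₂ F ψ)).hom).symm
  have h : F.map ψ.hom.op ≫ F.map φ.hom.op = F.map (φ ≫ ψ).hom.op := map_op_comp F rfl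
  have e : (quant₂ 𝒜 (field₂ F (φ ≫ ψ))).hom =
      (quant₂ 𝒜 (field₂ F φ)).hom.comp (quant₂ 𝒜 (field₂ F ψ)).hom :=
    FactHom.ext_maps (AlgHom.ext fun z => (𝒜.pullAlg_pullAlg h z).symm)
      (LinearMap.ext fun z => (𝒜.push_push h z).symm)
  exact congrArg (fun T => (ImmTwist.mk _ _ T).cls) e

theorem pushPull_map_id (X : BordObj S) :
    (pushPull F 𝒜).map (Bord.id X) = (LinearMap.id : ((pushPull F 𝒜).obj X).carrier →ₗ[_] _) := by
  refine LinearMap.ext fun z => (pushPull_map_apply 𝒜 _ z).trans ?_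
  rw [map_id_innEmb, map_id_outEmb]
  exact (𝒜.push_id_apply _ _).trans (𝒜.pullAlg_id_apply _ z)

section Composition

variable {X Y Z : BordObj S} {W : Bord X Y} {W' : Bord Y Z} {P : Bord X Z}

theorem pushPull_map_comp (hF : SeifertVanKampen F) (c : Bord.Composite W W' P) :
    (pushPull F 𝒜).map P =
      OneHom.comp ((pushPull F 𝒜).map W') ((pushPull F 𝒜).map W) := by
  refine LinearMap.ext fun (z : Fib 𝒜.A (fieldObj F X)) => ?_
  change 𝒜.push (F.map P.outEmb.op) (pullAlg 𝒜.A (F.map P.innEmb.op) z) =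
    𝒜.push (F.map W'.outEmb.op) (pullAlg 𝒜.A (F.map W'.innEmb.op)
      (𝒜.push (F.map W.outEmb.op) (pullAlg 𝒜.A (F.map W.innEmb.op) z)))
  rw [𝒜.base_change (c.isPullback hF), 𝒜.pullAlg_pullAlg (map_op_comp F c.innEmb_fst),
    𝒜.push_push (map_op_comp F c.outEmb_snd)]

theorem pushPull_map₂_model (hF : SeifertVanKampen F) {Q : Bord X Z} (c : Bord.Composite W W' P)
    (d : Bord.Composite W W' Q) (φ : P ⟶ Q) (h : c.fst ≫ φ.hom = d.fst)
    (h' : c.snd ≫ φ.hom = d.snd) :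
    ∃ h : (pushPull F 𝒜).map P = (pushPull F 𝒜).map Q,
      (pushPull F 𝒜).map₂ φ = eqToHom (congrArg TwistCat.of h) := by
  refine pushPull_map₂_of_isIso 𝒜 φ ?_
  have e : F.map φ.hom.op = ((d.isPullback hF).isoIsPullback _ _ (c.isPullback hF)).hom :=
    (c.isPullback hF).hom_ext (by simp only [map_op_comp F h, IsPullback.isoIsPullback_hom_fst])
      (by simp only [map_op_comp F h', IsPullback.isoIsPullback_hom_snd])
  rw [e]
  infer_instance

theorem pushPull_map₂_assoc (hF : SeifertVanKampen F) {X₁ X₂ X₃ X₄ : BordObj S} {W₁ : Bord X₁ X₂}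
    {W₂ : Bord X₂ X₃} {W₃ : Bord X₃ X₄} {W₁₂ : Bord X₁ X₃} {W₂₃ : Bord X₂ X₄} {P Q : Bord X₁ X₄}
    (c₁₂ : Bord.Composite W₁ W₂ W₁₂) (c₂₃ : Bord.Composite W₂ W₃ W₂₃)
    (c : Bord.Composite W₁₂ W₃ P) (d : Bord.Composite W₁ W₂₃ Q) (φ : P ⟶ Q)
    (e₁ : c₁₂.fst ≫ c.fst ≫ φ.hom = d.fst) (e₂ : c₁₂.snd ≫ c.fst ≫ φ.hom = c₂₃.fst ≫ d.snd)
    (e₃ : c.snd ≫ φ.hom = c₂₃.snd ≫ d.snd) :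
    ∃ h : (pushPull F 𝒜).map P = (pushPull F 𝒜).map Q,
      (pushPull F 𝒜).map₂ φ = eqToHom (congrArg TwistCat.of h) := by
  refine pushPull_map₂_of_isIso 𝒜 φ ?_
  have hp := c.isPullback hF
  have hq := d.isPullback hF
  rw [← map_op_comp F c₁₂.outEmb_snd] at hp
  rw [← map_op_comp F c₂₃.innEmb_fst] at hq
  refine isIso_of_isPullback_assoc (c₁₂.isPullback hF) (c₂₃.isPullback hF) hp hq _ ?_ ?_ ?_
  · rw [map_op_comp F rfl, map_op_comp F ((Category.assoc _ _ _).trans e₁)]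
  · rw [map_op_comp F rfl, map_op_square F ((Category.assoc _ _ _).trans e₂)]
  · exact map_op_square F e₃

/-- The base change of the identity of `F(X)` is invertible, and `F(φ)` is a section of it. -/
theorem pushPull_map₂_id_left (hF : SeifertVanKampen F) {W P : Bord X Y}
    (c : Bord.Composite (Bord.id X) W P) (φ : P ⟶ W) (h : c.snd ≫ φ.hom = 𝟙 _) :
    ∃ h : (pushPull F 𝒜).map P = (pushPull F 𝒜).map W,
      (pushPull F 𝒜).map₂ φ = eqToHom (congrArg TwistCat.of h) := by
  refine pushPull_map₂_of_isIso 𝒜 φ ?_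
  have : IsIso (F.map (Bord.id X).outEmb.op) := by
    rw [map_id_outEmb]
    exact inferInstanceAs (IsIso (𝟙 _))
  have := (c.isPullback hF).isIso_snd_of_isIso
  have e : F.map φ.hom.op ≫ F.map c.snd.op = 𝟙 _ := by rw [map_op_comp F h, op_id, F.map_id]
  exact IsIso.of_isIso_fac_right e

theorem pushPull_map₂_id_right (hF : SeifertVanKampen F) {W P : Bord X Y}
    (c : Bord.Composite W (Bord.id Y) P) (φ : P ⟶ W) (h : c.fst ≫ φ.hom = 𝟙 _) :
    ∃ h : (pushPull F 𝒜).map P = (pushPull F 𝒜).map W,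
      (pushPull F 𝒜).map₂ φ = eqToHom (congrArg TwistCat.of h) := by
  refine pushPull_map₂_of_isIso 𝒜 φ ?_
  have : IsIso (F.map (Bord.id Y).innEmb.op) := by
    rw [map_id_innEmb]
    exact inferInstanceAs (IsIso (𝟙 _))
  have := (c.isPullback hF).isIso_fst_of_isIso
  have e : F.map φ.hom.op ≫ F.map c.fst.op = 𝟙 _ := by rw [map_op_comp F h, op_id, F.map_id]
  exact IsIso.of_isIso_fac_right e

/-- The middle algebras correspond by pullback from `W` to `P`. -/
theorem pushPull_whisker_left (hF : SeifertVanKampen F) {W₁ : Bord X Y} {P₁ : Bord X Z}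
    (c : Bord.Composite W W' P) (c₁ : Bord.Composite W₁ W' P₁) (φ : W ⟶ W₁) (ψ : P ⟶ P₁)
    (e : c.fst ≫ ψ.hom = φ.hom ≫ c₁.fst) (e' : c.snd ≫ ψ.hom = c₁.snd) :
    (quant₂ 𝒜 (field₂ F φ)).Compatible (LinearMap.id : _ →ₗ[𝒜.base] _) ((pushPull F 𝒜).map W')
      (quant₂ 𝒜 (field₂ F ψ)) := by
  have key : ∀ {W : Bord X Y} {P : Bord X Z} (c : Bord.Composite W W' P)
      (z : Fib 𝒜.A (F.obj (op W.emb))),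
      𝒜.push (F.map W'.outEmb.op) (pullAlg 𝒜.A (F.map W'.innEmb.op)
        (𝒜.push (F.map W.outEmb.op) z)) =
      𝒜.push (F.map P.outEmb.op) (pullAlg 𝒜.A (F.map c.fst.op) z) := fun c z => by
    rw [𝒜.base_change (c.isPullback hF), 𝒜.push_push (map_op_comp F c.outEmb_snd)]
  refine ⟨(pullAlg 𝒜.A (F.map c.fst.op)).toLinearMap, (pullAlg 𝒜.A (F.map c₁.fst.op)).toLinearMap,
    LinearMap.ext fun z => 𝒜.pullAlg_pullAlg (map_op_comp F c.innEmb_fst) z,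
    LinearMap.ext fun z => 𝒜.pullAlg_pullAlg (map_op_comp F c₁.innEmb_fst) z,
    LinearMap.ext fun z => key c z, LinearMap.ext fun z => key c₁ z,
    LinearMap.ext fun z => ?_, LinearMap.ext fun z =>
      𝒜.base_change (c.isPullback_whisker_left hF c₁ φ ψ e e') z⟩
  exact (𝒜.pullAlg_pullAlg (map_op_square F e.symm) z).trans (𝒜.pullAlg_pullAlg rfl z).symm

/-- The middle algebras correspond by pushforward from `P` to `W'`. -/
theorem pushPull_whisker_right (hF : SeifertVanKampen F) {W₁' : Bord Y Z} {P₁ : Bord X Z}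
    (c : Bord.Composite W W' P) (c₁ : Bord.Composite W W₁' P₁) (φ : W' ⟶ W₁') (ψ : P ⟶ P₁)
    (e : c.fst ≫ ψ.hom = c₁.fst) (e' : c.snd ≫ ψ.hom = φ.hom ≫ c₁.snd) :
    (quant₂ 𝒜 (field₂ F ψ)).Compatible ((pushPull F 𝒜).map W) (LinearMap.id : _ →ₗ[𝒜.base] _)
      (quant₂ 𝒜 (field₂ F φ)) := by
  have key : ∀ {W' : Bord Y Z} {P : Bord X Z} (c : Bord.Composite W W' P)
      (z : Fib 𝒜.A (fieldObj F X)),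
      𝒜.push (F.map c.snd.op) (pullAlg 𝒜.A (F.map P.innEmb.op) z) =
      pullAlg 𝒜.A (F.map W'.innEmb.op)
        (𝒜.push (F.map W.outEmb.op) (pullAlg 𝒜.A (F.map W.innEmb.op) z)) := fun c z => by
    rw [𝒜.base_change (c.isPullback hF), 𝒜.pullAlg_pullAlg (map_op_comp F c.innEmb_fst)]
  refine ⟨𝒜.push (F.map c.snd.op), 𝒜.push (F.map c₁.snd.op),
    LinearMap.ext fun z => key c z, LinearMap.ext fun z => key c₁ z,
    LinearMap.ext fun z => (𝒜.push_push (map_op_comp F c.outEmb_snd) z).symm,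
    LinearMap.ext fun z => (𝒜.push_push (map_op_comp F c₁.outEmb_snd) z).symm,
    LinearMap.ext fun z => ?_, LinearMap.ext fun z => ?_⟩
  · exact (𝒜.base_change (c.isPullback_whisker_right hF c₁ φ ψ e e').flip z).symm
  · exact (𝒜.push_push (map_op_square F e') z).trans (𝒜.push_push rfl z).symm

end Composition

section Sums

variable {X X' P Y Y' Q : BordObj S} {hP : ObjSum X X' P} {hQ : ObjSum Y Y' Q}
  {W : Bord X Y} {W' : Bord X' Y'} {V : Bord P Q}

theorem BordSum.innEmb_inl (c : BordSum hP hQ W W' V) : W.innEmb ≫ c.inl = hP.inl ≫ V.innEmb :=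
  EmbS.incl_comp_eq c.inn _ _ _ _

theorem BordSum.innEmb_inr (c : BordSum hP hQ W W' V) : W'.innEmb ≫ c.inr = hP.inr ≫ V.innEmb :=
  EmbS.incl_comp_eq c.inn' _ _ _ _

theorem BordSum.outEmb_inl (c : BordSum hP hQ W W' V) : W.outEmb ≫ c.inl = hQ.inl ≫ V.outEmb :=
  EmbS.incl_comp_eq c.out _ _ _ _

theorem BordSum.outEmb_inr (c : BordSum hP hQ W W' V) : W'.outEmb ≫ c.inr = hQ.inr ≫ V.outEmb :=
  EmbS.incl_comp_eq c.out' _ _ _ _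

theorem pullAlg_innEmb_mul (c : BordSum hP hQ W W' V) (z : Fib 𝒜.A (fieldObj F X))
    (w : Fib 𝒜.A (fieldObj F X')) :
    pullAlg 𝒜.A (F.map V.innEmb.op)
        (pullAlg 𝒜.A (F.map hP.inl.op) z * pullAlg 𝒜.A (F.map hP.inr.op) w) =
      pullAlg 𝒜.A (F.map c.inl.op) (pullAlg 𝒜.A (F.map W.innEmb.op) z) *
        pullAlg 𝒜.A (F.map c.inr.op) (pullAlg 𝒜.A (F.map W'.innEmb.op) w) := by
  rw [map_mul, 𝒜.pullAlg_pullAlg (map_op_square F c.innEmb_inl.symm),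
    𝒜.pullAlg_pullAlg (map_op_square F c.innEmb_inr.symm), 𝒜.pullAlg_pullAlg rfl,
    𝒜.pullAlg_pullAlg rfl]

/-- Both `F(W ⊔ W')` and `F(Y ⊔ Y')` are products, so the external product is natural for the
pushforwards. -/
theorem push_outEmb_mul (hS : IsSheaf S) (hF : SeifertVanKampen F) (c : BordSum hP hQ W W' V)
    (z : Fib 𝒜.A (F.obj (op W.emb))) (w : Fib 𝒜.A (F.obj (op W'.emb))) :
    𝒜.push (F.map V.outEmb.op)
        (pullAlg 𝒜.A (F.map c.inl.op) z * pullAlg 𝒜.A (F.map c.inr.op) w) =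
      pullAlg 𝒜.A (F.map hQ.inl.op) (𝒜.push (F.map W.outEmb.op) z) *
        pullAlg 𝒜.A (F.map hQ.inr.op) (𝒜.push (F.map W'.outEmb.op) w) :=
  𝒜.external (c.isLimit hF hS) (hQ.isLimit hF hS) _ _ _ (map_op_square F c.outEmb_inl.symm)
    (map_op_square F c.outEmb_inr.symm) z w

theorem pushPull_mu_natural (hS : IsSheaf S) (hF : SeifertVanKampen F)
    (c : BordSum hP hQ W W' V) :
    OneHom.comp ((pushPull F 𝒜).map V) ((pushPull F 𝒜).mu hP) =
      OneHom.comp ((pushPull F 𝒜).mu hQ)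
        (((pushPull F 𝒜).map W).tensor ((pushPull F 𝒜).map W')) :=
  TensorProduct.ext' fun z w =>
    (congrArg (𝒜.push (F.map V.outEmb.op)) (pullAlg_innEmb_mul 𝒜 c z w)).trans
      (push_outEmb_mul 𝒜 hS hF c _ _)

/-- The middle algebras correspond by the external product. -/
theorem pushPull_mu_natural₂ (hS : IsSheaf S) (hF : SeifertVanKampen F) {W₁ : Bord X Y}
    {W₁' : Bord X' Y'} {V₁ : Bord P Q} (c : BordSum hP hQ W W' V)
    (c₁ : BordSum hP hQ W₁ W₁' V₁) (φ : W ⟶ W₁) (φ' : W' ⟶ W₁') (ψ : V ⟶ V₁)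
    (e : c.inl ≫ ψ.hom = φ.hom ≫ c₁.inl) (e' : c.inr ≫ ψ.hom = φ'.hom ≫ c₁.inr) :
    ((quant₂ 𝒜 (field₂ F φ)).tensor (quant₂ 𝒜 (field₂ F φ'))).Compatible
      ((pushPull F 𝒜).mu hP) ((pushPull F 𝒜).mu hQ) (quant₂ 𝒜 (field₂ F ψ)) := by
  refine ⟨(Algebra.TensorProduct.productMap (pullAlg 𝒜.A (F.map c.inl.op))
      (pullAlg 𝒜.A (F.map c.inr.op))).toLinearMap,
    (Algebra.TensorProduct.productMap (pullAlg 𝒜.A (F.map c₁.inl.op))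
      (pullAlg 𝒜.A (F.map c₁.inr.op))).toLinearMap,
    TensorProduct.ext' fun z w => (pullAlg_innEmb_mul 𝒜 c z w).symm,
    TensorProduct.ext' fun z w => (pullAlg_innEmb_mul 𝒜 c₁ z w).symm,
    TensorProduct.ext' fun z w => (push_outEmb_mul 𝒜 hS hF c z w).symm,
    TensorProduct.ext' fun z w => (push_outEmb_mul 𝒜 hS hF c₁ z w).symm,
    TensorProduct.ext' fun (z : Fib 𝒜.A (F.obj (op W.emb)))
      (w : Fib 𝒜.A (F.obj (op W'.emb))) => ?_,
    TensorProduct.ext' fun z w => ?_⟩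
  · change pullAlg 𝒜.A (F.map c₁.inl.op) (pullAlg 𝒜.A (F.map φ.hom.op) z) *
        pullAlg 𝒜.A (F.map c₁.inr.op) (pullAlg 𝒜.A (F.map φ'.hom.op) w) =
      pullAlg 𝒜.A (F.map ψ.hom.op)
        (pullAlg 𝒜.A (F.map c.inl.op) z * pullAlg 𝒜.A (F.map c.inr.op) w)
    rw [map_mul, 𝒜.pullAlg_pullAlg (map_op_square F e.symm),
      𝒜.pullAlg_pullAlg (map_op_square F e'.symm), 𝒜.pullAlg_pullAlg rfl,
      𝒜.pullAlg_pullAlg rfl]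
  · exact (𝒜.external (c₁.isLimit hF hS) (c.isLimit hF hS) (F.map φ.hom.op) (F.map φ'.hom.op)
      (F.map ψ.hom.op) (map_op_square F e) (map_op_square F e') z w).symm

end Sums

theorem pushPull_mu_unit_left {E X : BordObj S} (hE : IsEmpty E.mfd.carrier) (h : ObjSum E X X)
    (h' : h.e' = 𝟙 _) (r : 𝒜.base) (z : Fib 𝒜.A (fieldObj F X)) :
    ((pushPull F 𝒜).mu h).toFun ((pushPull F 𝒜).unit E hE r ⊗ₜ z) = r • z := by
  have hi : h.inr = 𝟙 X.emb := by
    obtain ⟨_, _, _, e', _, _, _, _, _, _⟩ := h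
    dsimp at h'
    subst h'
    exact EmbS.incl_id _ _
  change pullAlg 𝒜.A (F.map h.inl.op) (algebraMap _ _ r) * pullAlg 𝒜.A (F.map h.inr.op) z = r • z
  rw [AlgHom.commutes, hi, op_id, F.map_id, 𝒜.pullAlg_id_apply, Algebra.smul_def]

theorem pushPull_mu_symm {X X' P : BordObj S} (h : ObjSum X X' P) (z : Fib 𝒜.A (fieldObj F X))
    (w : Fib 𝒜.A (fieldObj F X')) :
    ((pushPull F 𝒜).mu h.swap).toFun (w ⊗ₜ z) = ((pushPull F 𝒜).mu h).toFun (z ⊗ₜ w) :=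
  mul_comm (pullAlg 𝒜.A (F.map h.inr.op) w) (pullAlg 𝒜.A (F.map h.inl.op) z)

theorem pushPull_mu_unit_right {E X : BordObj S} (hE : IsEmpty E.mfd.carrier) (h : ObjSum X E X)
    (h' : h.e = 𝟙 _) (r : 𝒜.base) (z : Fib 𝒜.A (fieldObj F X)) :
    ((pushPull F 𝒜).mu h).toFun (z ⊗ₜ (pushPull F 𝒜).unit E hE r) = r • z :=
  (pushPull_mu_symm 𝒜 h z _).symm.trans (pushPull_mu_unit_left 𝒜 hE h.swap h' r z)

theorem pushPull_mu_assoc {X₁ X₂ X₃ P₁₂ P₂₃ P : BordObj S} (h₁₂ : ObjSum X₁ X₂ P₁₂)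
    (h₂₃ : ObjSum X₂ X₃ P₂₃) (h : ObjSum P₁₂ X₃ P) (k : ObjSum X₁ P₂₃ P)
    (e₁ : h₁₂.e ≫ h.e = k.e) (e₂ : h₁₂.e' ≫ h.e = h₂₃.e ≫ k.e') (e₃ : h.e' = h₂₃.e' ≫ k.e')
    (z₁ : Fib 𝒜.A (fieldObj F X₁)) (z₂ : Fib 𝒜.A (fieldObj F X₂))
    (z₃ : Fib 𝒜.A (fieldObj F X₃)) :
    ((pushPull F 𝒜).mu h).toFun (((pushPull F 𝒜).mu h₁₂).toFun (z₁ ⊗ₜ z₂) ⊗ₜ z₃) =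
      ((pushPull F 𝒜).mu k).toFun (z₁ ⊗ₜ ((pushPull F 𝒜).mu h₂₃).toFun (z₂ ⊗ₜ z₃)) := by
  have i₁ : h₁₂.inl ≫ h.inl = k.inl := EmbS.incl_comp _ _ e₁ _ _ _
  have i₂ : h₁₂.inr ≫ h.inl = h₂₃.inl ≫ k.inr := EmbS.incl_comp_eq e₂ _ _ _ _
  have i₃ : h₂₃.inr ≫ k.inr = h.inr := EmbS.incl_comp _ _ e₃.symm _ _ _
  change pullAlg 𝒜.A (F.map h.inl.op)
        (pullAlg 𝒜.A (F.map h₁₂.inl.op) z₁ * pullAlg 𝒜.A (F.map h₁₂.inr.op) z₂) *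
      pullAlg 𝒜.A (F.map h.inr.op) z₃ =
    pullAlg 𝒜.A (F.map k.inl.op) z₁ * pullAlg 𝒜.A (F.map k.inr.op)
      (pullAlg 𝒜.A (F.map h₂₃.inl.op) z₂ * pullAlg 𝒜.A (F.map h₂₃.inr.op) z₃)
  rw [map_mul, map_mul, 𝒜.pullAlg_pullAlg (map_op_comp F i₁),
    𝒜.pullAlg_pullAlg (map_op_square F i₂), 𝒜.pullAlg_pullAlg rfl,
    𝒜.pullAlg_pullAlg (map_op_comp F i₃), mul_assoc]

end PushPull

end PushPull

theorem mainTheorem2 {m : ℕ} (S : (PushPull.EmbC m)ᵒᵖ ⥤ Cat.{w₁, w₂}) (hS : PushPull.IsSheaf S)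
    {C : Type u₁} [Category.{u₂} C] [HasTerminal C] [HasPullbacks C]
    (F : (PushPull.EmbS S)ᵒᵖ ⥤ C) (hF : PushPull.SeifertVanKampen F)
    (𝒜 : PushPull.CAlgebra.{u₁, u₂, v} C) :
    ∃ Z : PushPull.LaxMonoidalTQFT S 𝒜.base, Z.toPreTQFT = PushPull.pushPull F 𝒜 := by
  refine ⟨{ PushPull.pushPull F 𝒜 with
    map₂_id := PushPull.pushPull_map₂_id 𝒜
    map₂_comp := PushPull.pushPull_map₂_comp 𝒜
    map_id := PushPull.pushPull_map_id 𝒜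
    map_comp := PushPull.pushPull_map_comp 𝒜 hF
    map₂_model := PushPull.pushPull_map₂_model 𝒜 hF
    map₂_assoc := PushPull.pushPull_map₂_assoc 𝒜 hF
    map₂_id_left := PushPull.pushPull_map₂_id_left 𝒜 hF
    map₂_id_right := PushPull.pushPull_map₂_id_right 𝒜 hF
    map₂_whisker_left := fun c c₁ φ ψ e e' =>
      ⟨_, _, rfl, rfl, PushPull.pushPull_whisker_left 𝒜 hF c c₁ φ ψ e e'⟩
    map₂_whisker_right := fun c c₁ φ ψ e e' =>
      ⟨_, _, rfl, rfl, PushPull.pushPull_whisker_right 𝒜 hF c c₁ φ ψ e e'⟩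
    mu_natural := PushPull.pushPull_mu_natural 𝒜 hS hF
    mu_natural₂ := fun c c₁ φ φ' ψ e e' =>
      ⟨_, _, _, rfl, rfl, rfl, PushPull.pushPull_mu_natural₂ 𝒜 hS hF c c₁ φ φ' ψ e e'⟩
    mu_unit_left := PushPull.pushPull_mu_unit_left 𝒜
    mu_unit_right := PushPull.pushPull_mu_unit_right 𝒜
    mu_assoc := PushPull.pushPull_mu_assoc 𝒜
    mu_symm := PushPull.pushPull_mu_symm 𝒜 }, rfl⟩
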